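/- Setting. Let $d\ge 1$. The $d$-dimensional simplicial lattice is $\{x\in\mathbb Z^{d+1}: x_1+\dots+x_{d+1}=0\}$ with the Manhattan distance $\mathsf d(x,y)=\sum_p\max(x_p-y_p,0)$ (nearest neighbours differ by $e_p-e_q$, $p\ne q$). A simplex is a non-empty set $\{x: x_p\ge a_p \text{ for all } p\}$ of lattice points with $a\in\mathbb Z^{d+1}$ (so all simplices have the same orientation, and single points are simplices). Let $\Lambda$ be a finite region of this lattice in the form of a simplex, of arbitrary size, with a qudit of dimension $q_i\ge 1$ at each $i\in\Lambda$, and let $\mathcal H=\bigotimes_{i\in\Lambda}\mathbb C^{q_i}$. (Sites with $q_i=1$ carry no degree of freedom.) Operators on $\mathcal H$ carry the operator norm. For $S\subseteq\Lambda$ put $\mathrm{diam}\,S=\max_{i,j\in S}\mathsf d(i,j)$, $\partial S=\{i\in S:\exists j\in\Lambda\setminus S,\ \mathsf d(i,j)=1\}$ and $\mathsf d(S,S')=\min_{i\in S,j\in S'}\mathsf d(i,j)$. For $0<\alpha<1$ and $\kappa\ge 0$ the $\kappa$-norm is $$\|O\|_{\kappa}=\inf_{\{O_S\}}\ \max_{i\in\Lambda}\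 \sum_{S\ni i}e^{\kappa(\mathrm{diam}\,S)^\alpha}\|O_S\|,$$ the infimum being over all decompositions $O=\sum_S O_S$ over simplices $S\subseteq\Lambda$, with $O_S$ supported inside $S$. Let $H_0$ be a self-adjoint operator on $\mathcal H$ and $\mathcal L_0O=i[H_0,O]$. We say that $H_0$ satisfies the Lieb–Robinson bound with parameters $\mu,\mu',u$ if $$\big\|[e^{t\mathcal L_0}A,B]\big\|\le 2\|A\|\,\|B\|\,\mu'\min(|\partial S|,|\partial S'|)\,e^{\mu(u|t|-\mathsf d(S,S'))}$$ for all $t\in\mathbb R$, all disjoint $S,S'\subseteq\Lambda$, and all $A$, $B$ supported inside $S$, $S'$ respectively. For $\Delta>0$, an operator $O$ is $\Delta$-diagonal if $\langle\psi|O|\psi'\rangle=0$ whenever $\psi,\psi'$ are eigenvectors of $H_0$ with eigenvalues $E,E'$ such that $|E-E'|\ge\Delta$. Proposition. For every $\Delta>0$ there are functions $w=w_\Delta$ and $W=W_\Delta$ in $L^1(\mathbb R;\mathbb R)$, depending only on $\Delta$, such that the superoperators $$\mathbb P O=\int_{-\infty}^\infty w(t)\,e^{t\mathcal L_0}O\,dt,\qquad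 \mathbb A O=i\int_{-\infty}^\infty W(t)\,e^{t\mathcal L_0}O\,dt$$ have the following properties. 1. For all $d$, $\Lambda$, $(q_i)$ and $H_0$ as above and every operator $O$, $\mathbb P O$ is $\Delta$-diagonal and $[H_0,\mathbb A O]+O=\mathbb P O$. 2. Let $d\ge1$, $0<\alpha<1$, $\mu,\mu',\rho\in\mathbb R$ and $0<\kappa_1\le\mu/5$. There are constants $c_w,c_W$, depending only on $\alpha,d,\kappa_1,\mu,\mu'$ and $\rho$ (and not on $\Lambda$, $(q_i)$, $H_0$, $\Delta$), such that the following holds for all $\Lambda$, $(q_i)$, $\Delta>0$, and all $u$ with $u/\Delta=\rho$. If $H_0$ satisfies the Lieb–Robinson bound with parameters $\mu,\mu',u$, then for all $0\le\kappa'<\kappa\le\kappa_1$ and every operator $O$, with $\delta\kappa=\kappa-\kappa'$, $$\|\mathbb P O\|_{\kappa'}\le c_w\,[\max(1,-\ln\delta\kappa)]^{d-1}\,\|O\|_\kappa,\qquad \|\mathbb A O\|_{\kappa'}\le \frac{c_W}{\Delta}\,[\max(1,-\ln\delta\kappa)]^{d-1}\,\|O\|_\kappa .$$ -/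

import Mathlib

noncomputable section

namespace Prethermal

/-! ### The simplicial lattice -/

/-- The `d`-dimensional simplicial lattice: the integer points of `ℝ^(d+1)` lying on the
hyperplane `x₁ + ⋯ + x_{d+1} = 0`.  Nearest neighbours differ by `e_p - e_q` with `p ≠ q`. -/
abbrev SimplicialLattice (d : ℕ) : Type := {x : Fin (d + 1) → ℤ // ∑ p, x p = 0}

/-- The Manhattan distance on the simplicial lattice, that is, the least number of
nearest-neighbour steps `e_p - e_q` leading from `y` to `x`.  As `∑ p, (x p - y p) = 0`, it is the
sum of the positive parts of the coordinate differences (half of their `ℓ¹` norm). -/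
def latticeDist {d : ℕ} (x y : SimplicialLattice d) : ℕ := ∑ p, (x.1 p - y.1 p).toNat

/-- The simplices of the fixed orientation: all lattice points `x` with `a p ≤ x p` for every `p`.
The number `-∑ p, a p` is the side length; side length `0` gives the single points.
The vertices are the points obtained from `a` by adding the side length to one coordinate. -/
def IsSimplex {d : ℕ} (S : Finset (SimplicialLattice d)) : Prop :=
  ∃ a : Fin (d + 1) → ℤ, ∑ p, a p ≤ 0 ∧ ∀ x : SimplicialLattice d, x ∈ S ↔ ∀ p, a p ≤ x.1 p

/-! ### The Liouvillian (for an arbitrary Banach algebra of operators) -/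

section Liouvillian

variable {𝔸 : Type*} [NormedRing 𝔸] [NormedAlgebra ℂ 𝔸]

/-- The Liouvillian superoperator `𝓛₀ O = i [H₀, O] = i (H₀ O - O H₀)`. -/
def liouvillian (H₀ : 𝔸) : 𝔸 →L[ℂ] 𝔸 :=
  Complex.I • (ContinuousLinearMap.mul ℂ 𝔸 H₀ - (ContinuousLinearMap.mul ℂ 𝔸).flip H₀)

/-- The superoperator `e^{t 𝓛₀}`, the exponential of the bounded linear map `t 𝓛₀`. -/
def evolution (H₀ : 𝔸) (t : ℝ) : 𝔸 →L[ℂ] 𝔸 :=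
  NormedSpace.exp ((t : ℂ) • liouvillian H₀)

end Liouvillian

section Region

variable {d : ℕ} {Λ : Finset (SimplicialLattice d)}

/-- The simplices contained in `Λ`. -/
def simplices (Λ : Finset (SimplicialLattice d)) : Finset (Finset Λ) :=
  open Classical in
  Finset.univ.filter fun S => IsSimplex (S.map (Function.Embedding.subtype _))

/-- `diam S = max_{i, j ∈ S} d(i, j)`. -/
def diam (S : Finset Λ) : ℕ := S.sup fun i => S.sup fun j => latticeDist i.1 j.1

/-- `∂S = {i ∈ S : there is a vertex j ∉ S of Λ with d(i, j) = 1}`. -/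
def boundary (S : Finset Λ) : Finset Λ :=
  open Classical in
  S.filter fun i => ∃ j : Λ, j ∉ S ∧ latticeDist i.1 j.1 = 1

/-- `d(S, S') = min_{i ∈ S, j ∈ S'} d(i, j)`. -/
def setDist (S S' : Finset Λ) : ℕ :=
  sInf {n : ℕ | ∃ i ∈ S, ∃ j ∈ S', n = latticeDist i.1 j.1}

/-! ### Operators on the many-body Hilbert space -/

/-- Product-basis labels of the many-body Hilbert space with a `q i`-dimensional qudit at every
site `i` of `Λ`. -/
abbrev Config (q : Λ → ℕ) : Type := ∀ i : Λ, Fin (q i)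

/-- The many-body Hilbert space `⨂_{i ∈ Λ} ℂ^(q i)`, in its product basis. -/
abbrev HilbertSpace (q : Λ → ℕ) : Type := EuclideanSpace ℂ (Config q)

/-- Operators on the many-body Hilbert space, with the operator norm (largest singular value). -/
abbrev Op (q : Λ → ℕ) : Type := HilbertSpace q →L[ℂ] HilbertSpace q

variable {q : Λ → ℕ}

/-- The matrix of `A ⊗ 1`, for `A` acting on the sites in `S` and the identity on the others. -/
def extendMatrix (S : Finset Λ) (A : Matrix (∀ i : S, Fin (q i)) (∀ i : S, Fin (q i)) ℂ) :
    Matrix (Config q) (Config q) ℂ :=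
  fun x y => if ∀ i, i ∉ S → x i = y i then A (fun i => x i) (fun i => y i) else 0

/-- `O` is supported inside `S`, that is, `O = A ⊗ 1` with `A` acting on the sites in `S`. -/
def SupportedIn (S : Finset Λ) (O : Op q) : Prop :=
  ∃ A : Matrix (∀ i : S, Fin (q i)) (∀ i : S, Fin (q i)) ℂ,
    O = Matrix.toEuclideanCLM (n := Config q) (𝕜 := ℂ) (extendMatrix S A)

/-- `f` is a local decomposition `O = ∑_S O_S` over the simplices `S ⊆ Λ`, with `O_S = f S`
supported inside `S`. -/
def IsLocalDecomposition (O : Op q) (f : Finset Λ → Op q) : Prop :=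
  (∀ S ∈ simplices Λ, SupportedIn S (f S)) ∧ O = ∑ S ∈ simplices Λ, f S

/-- `∑_{S ∋ i} e^{κ (diam S)^α} ‖O_S‖`, for the local decomposition `O_S = f S`. -/
def localNormAt (α κ : ℝ) (f : Finset Λ → Op q) (i : Λ) : ℝ :=
  ∑ S ∈ (simplices Λ).filter (fun S => i ∈ S), Real.exp (κ * (diam S : ℝ) ^ α) * ‖f S‖

/-- The `(α, κ)`-norm: the infimum over all local decompositions of
`max_{i ∈ Λ} ∑_{S ∋ i} e^{κ (diam S)^α} ‖O_S‖`. -/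
def kappaNorm (α κ : ℝ) (O : Op q) : ℝ :=
  sInf {r : ℝ | ∃ f : Finset Λ → Op q, IsLocalDecomposition O f ∧ r = ⨆ i : Λ, localNormAt α κ f i}

/-- The Lieb-Robinson bound with parameters `μ`, `μ'`, `u`. -/
def LiebRobinsonBound (H₀ : Op q) (μ μ' u : ℝ) : Prop :=
  ∀ S S' : Finset Λ, Disjoint S S' → ∀ A B : Op q, SupportedIn S A → SupportedIn S' B → ∀ t : ℝ,
    ‖⁅evolution H₀ t A, B⁆‖ ≤
      2 * ‖A‖ * ‖B‖ * μ' * min ((boundary S).card : ℝ) ((boundary S').card : ℝ) *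
        Real.exp (μ * (u * |t| - (setDist S S' : ℝ)))

/-- `O` is `Δ`-diagonal with respect to `H₀`: `⟨E|O|E'⟩ = 0` for all eigenstates of `H₀` with
`|E - E'| ≥ Δ`. -/
def IsDeltaDiagonal (H₀ : Op q) (Δ : ℝ) (O : Op q) : Prop :=
  ∀ (E E' : ℝ) (ψ ψ' : HilbertSpace q), H₀ ψ = (E : ℂ) • ψ → H₀ ψ' = (E' : ℂ) • ψ' →
    Δ ≤ |E - E'| → inner ℂ ψ (O ψ') = 0

/-- `ℙ O = ∫ w(t) e^{t 𝓛₀} O dt`. -/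
def superP (w : ℝ → ℝ) (H₀ O : Op q) : Op q :=
  ∫ t : ℝ, (w t : ℂ) • evolution H₀ t O

/-- `𝔸 O = i ∫ W(t) e^{t 𝓛₀} O dt`. -/
def superA (W : ℝ → ℝ) (H₀ O : Op q) : Op q :=
  Complex.I • ∫ t : ℝ, (W t : ℂ) • evolution H₀ t O

end Region

end Prethermal

end

/-! Filter. The matrix element of `ℙ O` between eigenvectors with energies `E`, `E'` is that of `O`
times the Fourier transform of `w` at `E - E'`, so `ℙ O` is `Δ`-diagonal once `w` has its spectrum
in `(-Δ, Δ)`. If `W` is minus a primitive of `w`, with a unit jump at `0` so that it vanishes at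
both infinities, integration by parts gives `[H₀, 𝔸 O] + O = ℙ O`, the `O` coming from the jump. One
`w` must serve every `α < 1` and every constant, so it has to decay faster than all stretched
exponentials. It is built as a band-limited bump times an infinite product of powers of sinc
functions whose total bandwidth is finite (`exists_bandLimited_filter`), then rescaled by `Δ`
(`exists_isFilterPair`).

Localisation. Take any decomposition `O = ∑ O_S` and average each `O_S` in time. For a distance `r`,
times `Δ|t|` small against `r` are controlled by Lieb–Robinson and larger ones by the decay of the
weight. Hence the averaged `O_S` nearly commutes with everything outside the simplex `S` enlarged by
`r`, up to `exp(-K r^α)` (`exists_norm_lie_evolution_le`). A finite-group twirl turns this into a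
nearby operator supported in the enlargement (`exists_supportedIn_near`), and telescoping in `r`
gives a new local decomposition (`exists_enlarge_decomposition`).

Logarithm. The Lieb–Robinson prefactor `|∂S|` is polynomial in `diam S`. It is absorbed by starting
the telescoping at a radius `r₀` proportional to `log diam S`. This costs only a constant in `exp(κ
(diam S)^α)`, but the first term has no decay in `r`, so one must count the `S` whose
`r₀`-enlargement contains a given site. As all simplices have the same orientation, those in one
dyadic range of diameters are hit by boundedly many points, so each range contributes a bounded
multiple of the norm. Only about `-log δκ` ranges matter because of the gap `κ - κ'`. This gives one
logarithm for `d ≥ 2`, which is at most its power `d - 1`. For `d = 1` the boundary is bounded, `r₀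
= 0`, and no logarithm appears (`exists_sum_logRadius_le`). The later terms decay like `exp(-r^α)`,
which beats polynomial counting (`exists_localDecomposition_le`). -/

noncomputable section
namespace Prethermal
open MeasureTheory Filter Topology

/-! ### Band-limited functions -/

/-- `f` is integrable and its Fourier transform vanishes outside `(-A, A)`. -/
def HasBand (A : ℝ) (f : ℝ → ℂ) : Prop :=
  Integrable f ∧ ∀ ω : ℝ, A ≤ |ω| → ∫ t : ℝ, Complex.exp ((ω * t : ℝ) * Complex.I) * f t = 0

lemma HasBand.mono {A B : ℝ} {f : ℝ → ℂ} (h : HasBand A f) (hAB : A ≤ B) : HasBand B f :=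
  ⟨h.1, fun ω hω => h.2 ω (hAB.trans hω)⟩

lemma HasBand.congr {A B : ℝ} {f g : ℝ → ℂ} (h : HasBand A f) (hAB : A = B)
    (hfg : ∀ t, f t = g t) : HasBand B g := by
  obtain rfl := hAB
  obtain rfl : f = g := funext hfg
  exact h

/-- Multiplication by `m` averages `f` over modulations by frequencies `k s` of size at most `a`, so
the band grows by at most `a`. The interchange of integrals is Fubini. -/
lemma HasBand.mul {A a k : ℝ} {f φ m : ℝ → ℂ} (h : HasBand A f) (hφ : Integrable φ)
    (hφa : ∀ s, a < |k * s| → φ s = 0)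
    (hm : ∀ t, m t = ∫ s : ℝ, φ s * Complex.exp ((k * s * t : ℝ) * Complex.I)) :
    HasBand (A + a) fun t => f t * m t := by
  have key : ∀ ω : ℝ, Integrable (Function.uncurry fun t s : ℝ =>
      Complex.exp ((ω * t : ℝ) * Complex.I) * f t *
        (φ s * Complex.exp ((k * s * t : ℝ) * Complex.I))) (volume.prod volume) := by
    intro ω
    have h1 := h.1.mul_prod hφ
    have h2 : Integrable (fun p : ℝ × ℝ => Complex.exp ((ω * p.1 + k * p.2 * p.1 : ℝ) * Complex.I)
        * (f p.1 * φ p.2)) (volume.prod volume) := by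
      refine h1.bdd_mul (c := 1) ?_ ?_
      · exact Continuous.aestronglyMeasurable (by fun_prop)
      · exact Eventually.of_forall fun p => by rw [Complex.norm_exp_ofReal_mul_I]
    refine h2.congr (Eventually.of_forall fun p => ?_)
    simp only [Function.uncurry, Complex.ofReal_add, add_mul, Complex.exp_add]
    ring
  have hin : ∀ ω t : ℝ, ∫ s : ℝ, Complex.exp ((ω * t : ℝ) * Complex.I) * f t *
        (φ s * Complex.exp ((k * s * t : ℝ) * Complex.I)) =
      Complex.exp ((ω * t : ℝ) * Complex.I) * (f t * m t) := by
    intro ω t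
    rw [integral_const_mul, hm]; ring
  refine ⟨?_, fun ω hω => ?_⟩
  · have := (key 0).integral_prod_left
    refine this.congr (Eventually.of_forall fun t => ?_)
    simp only [Function.uncurry]
    rw [hin]; simp
  · simp_rw [← hin]
    rw [integral_integral_swap (key ω)]
    refine integral_eq_zero_of_ae (Eventually.of_forall fun s => ?_)
    by_cases hs : a < |k * s|
    · simp [hφa s hs]
    · have h3 : ∀ t : ℝ, Complex.exp ((ω * t : ℝ) * Complex.I) * f t *
          (φ s * Complex.exp ((k * s * t : ℝ) * Complex.I)) =
          φ s * (Complex.exp (((ω + k * s) * t : ℝ) * Complex.I) * f t) := by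
        intro t
        rw [add_mul, Complex.ofReal_add, add_mul, Complex.exp_add]; ring
      simp_rw [h3]
      rw [integral_const_mul, h.2 (ω + k * s), mul_zero]
      · rfl
      · have := abs_add_le (ω + k * s) (-(k * s))
        rw [abs_neg, add_neg_cancel_right] at this
        linarith [not_lt.mp hs]

lemma sinc_eq_integral (a t : ℝ) :
    ((Real.sinc (a * t) : ℝ) : ℂ) = ∫ s : ℝ, (Set.Ioc (-1 : ℝ) 1).indicator (fun _ => (1 / 2 : ℂ)) s *
      Complex.exp ((a * s * t : ℝ) * Complex.I) := by
  have h1 : ∀ s : ℝ, (Set.Ioc (-1 : ℝ) 1).indicator (fun _ => (1 / 2 : ℂ)) s *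
      Complex.exp ((a * s * t : ℝ) * Complex.I) = (Set.Ioc (-1 : ℝ) 1).indicator
        (fun s : ℝ => (1 / 2 : ℂ) * Complex.exp ((a * t * Complex.I) * s)) s := by
    intro s
    by_cases hs : s ∈ Set.Ioc (-1 : ℝ) 1
    · simp only [Set.indicator_of_mem hs]
      congr 2; push_cast; ring
    · simp only [Set.indicator_of_notMem hs, zero_mul]
  simp_rw [h1]
  rw [integral_indicator measurableSet_Ioc, ← intervalIntegral.integral_of_le (by norm_num),
    intervalIntegral.integral_const_mul]
  by_cases hat : a * t = 0
  · have : (a * t * Complex.I : ℂ) = 0 := by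
      rw [← Complex.ofReal_mul, hat]; simp
    simp [this, hat]; norm_num
  · have hne : (a * t * Complex.I : ℂ) ≠ 0 := by
      rw [← Complex.ofReal_mul]
      exact mul_ne_zero (by exact_mod_cast hat) Complex.I_ne_zero
    have hne' : (a * t : ℂ) ≠ 0 := by exact_mod_cast hat
    rw [integral_exp_mul_complex hne, Real.sinc_of_ne_zero hat]
    push_cast
    rw [Complex.sin]
    have : -(a * t * Complex.I) = (a * t * Complex.I : ℂ) * (-1) := by ring
    field_simp
    rw [Complex.I_sq]
    ring_nf

lemma HasBand.mul_sinc_pow {A a : ℝ} {f : ℝ → ℂ} (ha : 0 ≤ a) (h : HasBand A f) (n : ℕ) :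
    HasBand (A + n * a) fun t => f t * ((Real.sinc (a * t) ^ n : ℝ) : ℂ) := by
  induction n with
  | zero => simpa using h
  | succ n ih =>
    have hφ : Integrable ((Set.Ioc (-1 : ℝ) 1).indicator fun _ => (1 / 2 : ℂ)) :=
      (integrable_indicator_iff measurableSet_Ioc).2 (integrableOn_const (by simp) (by simp))
    have := ih.mul (a := a) (k := a) hφ (fun s hs => ?_) (fun t => sinc_eq_integral a t)
    · exact this.congr (by push_cast; ring) (fun t => by push_cast; ring)
    · refine Set.indicator_of_notMem (fun hs' => ?_) _
      have : |s| ≤ 1 := abs_le.2 ⟨hs'.1.le, hs'.2⟩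
      rw [abs_mul, abs_of_nonneg ha] at hs
      nlinarith

lemma HasBand.mul_prod_sinc_pow {A : ℝ} {f : ℝ → ℂ} {a : ℕ → ℝ} (ha : ∀ k, 0 ≤ a k) (n : ℕ → ℕ)
    (h : HasBand A f) (K : ℕ) :
    HasBand (A + ∑ k ∈ Finset.range K, n k * a k)
      fun t => f t * ((∏ k ∈ Finset.range K, Real.sinc (a k * t) ^ n k : ℝ) : ℂ) := by
  induction K with
  | zero => simpa using h
  | succ K ih =>
    have := ih.mul_sinc_pow (ha K) (n K)
    exact this.congr (by rw [Finset.sum_range_succ]; ring)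
      (fun t => by rw [Finset.prod_range_succ]; push_cast; ring)

/-- Dominated convergence, with dominating function `‖f‖`: vanishing of the transform outside the
band survives pointwise limits of bounded multipliers. -/
lemma HasBand.of_tendsto {A : ℝ} {f : ℝ → ℂ} (hf : Integrable f) {m : ℕ → ℝ → ℂ} {M : ℝ → ℂ}
    (hm : ∀ K, HasBand A fun t => f t * m K t) (hbd : ∀ K t, ‖m K t‖ ≤ 1)
    (hlim : ∀ t, Tendsto (fun K => m K t) atTop (𝓝 (M t))) :
    HasBand A fun t => f t * M t := by
  have hb : ∀ K t, ‖f t * m K t‖ ≤ ‖f t‖ := fun K t => by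
    rw [norm_mul]; exact mul_le_of_le_one_right (norm_nonneg _) (hbd K t)
  have hl : ∀ t, Tendsto (fun K => f t * m K t) atTop (𝓝 (f t * M t)) :=
    fun t => (hlim t).const_mul _
  refine ⟨hf.norm.mono' (aestronglyMeasurable_of_tendsto_ae atTop
    (fun K => (hm K).1.aestronglyMeasurable) (Eventually.of_forall hl))
    (Eventually.of_forall fun t => ?_), fun ω hω => ?_⟩
  · exact le_of_tendsto (hl t).norm (Eventually.of_forall fun K => hb K t)
  · have := tendsto_integral_of_dominated_convergence (μ := volume)
      (F := fun K t => Complex.exp ((ω * t : ℝ) * Complex.I) * (f t * m K t))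
      (f := fun t => Complex.exp ((ω * t : ℝ) * Complex.I) * (f t * M t)) (fun t => ‖f t‖)
      (fun K => (Continuous.aestronglyMeasurable (by fun_prop)).mul
        (hm K).1.aestronglyMeasurable) hf.norm
      (fun K => Eventually.of_forall fun t => by
        rw [norm_mul, Complex.norm_exp_ofReal_mul_I, one_mul]; exact hb K t)
      (Eventually.of_forall fun t => (hl t).const_mul _)
    refine tendsto_nhds_unique this ?_
    simp_rw [(hm _).2 ω hω]
    exact tendsto_const_nhds

open Real FourierTransform SchwartzMap ContDiff in
-- The function is `|g|²` with `g` the Fourier transform of a smooth bump. Both `g` and its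
-- conjugate have band `1/4`, the squared modulus is nonnegative, and `g 0` is the integral of the
-- bump.
lemma exists_hasBand_base : ∃ f : ℝ → ℝ, Continuous f ∧ (∀ t, 0 ≤ f t) ∧ 0 < f 0 ∧
    HasBand (1 / 2) fun t => (f t : ℂ) := by
  -- The outer radius `1/100` makes the angular frequencies `2πv` smaller than `1/4`.
  let b : ContDiffBump (0 : ℝ) := ⟨1 / 200, 1 / 100, by norm_num, by norm_num⟩
  have hs : HasCompactSupport fun x => ((b x : ℝ) : ℂ) := 
    b.hasCompactSupport.comp_left (g := ((↑) : ℝ → ℂ)) Complex.ofReal_zero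
  have hc : ContDiff ℝ ∞ fun x => ((b x : ℝ) : ℂ) := Complex.ofRealCLM.contDiff.comp b.contDiff
  let φ : 𝓢(ℝ, ℂ) := hs.toSchwartzMap hc
  have hφ : ∀ x, φ x = (b x : ℂ) := fun x => rfl
  let g : 𝓢(ℝ, ℂ) := 𝓕 φ
  have hg : ∀ t, g t = ∫ v : ℝ, Complex.exp (((-2 * π * v * t : ℝ)) * Complex.I) * (b v : ℂ) := by
    intro t
    have : g t = 𝓕 (φ : ℝ → ℂ) t := by rw [← SchwartzMap.fourier_coe]
    rw [this, Real.fourier_real_eq_integral_exp_smul]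
    rfl
  have hpi : 2 * π * (1 / 100) ≤ 1 / 4 := by nlinarith [Real.pi_lt_four]
  have hout : ∀ v : ℝ, 1 / 4 ≤ |2 * π * v| → b v = 0 := by
    intro v hv
    refine b.zero_of_le_dist ?_
    rw [dist_zero_right, Real.norm_eq_abs]
    rw [abs_mul, abs_of_pos (by positivity : (0:ℝ) < 2 * π)] at hv
    by_contra hlt
    push Not at hlt
    have hlt' : |v| < 1 / 100 := hlt
    have : 2 * π * |v| < 2 * π * (1 / 100) := by gcongr
    linarith
  have hband : HasBand (1 / 4) g := by
    refine ⟨g.integrable, fun y hy => ?_⟩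
    have h1 : (𝓕⁻ g) (y / (2 * π)) = φ (y / (2 * π)) := by
      rw [FourierTransform.fourierInv_fourier_eq]
    rw [SchwartzMap.fourierInv_coe, Real.fourierInv_eq', hφ, hout] at h1
    · rw [← Complex.ofReal_zero, ← h1]
      congr 1; ext t
      rw [smul_eq_mul]
      congr 4
      simp
      field_simp
    · rw [mul_div_cancel₀ _ (by positivity)]; exact hy
  have hconj : ∀ t, (starRingEnd ℂ) (g t) =
      ∫ s : ℝ, (b s : ℂ) * Complex.exp ((2 * π * s * t : ℝ) * Complex.I) := by
    intro t
    rw [hg, ← integral_conj]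
    congr 1; ext s
    rw [map_mul, Complex.conj_ofReal, ← Complex.exp_conj, map_mul, Complex.conj_ofReal,
      Complex.conj_I, mul_comm]
    congr 2; push_cast; ring
  refine ⟨fun t => ‖g t‖ ^ 2, by fun_prop, fun t => by positivity, ?_, ?_⟩
  · have : g 0 = ((∫ v, b v : ℝ) : ℂ) := by
      rw [hg, ← integral_complex_ofReal]; simp
    have hpos := b.integral_pos (μ := volume)
    show 0 < ‖g 0‖ ^ 2
    rw [this]
    exact pow_pos (norm_pos_iff.2 (by exact_mod_cast hpos.ne')) 2
  · have := hband.mul (a := 1 / 4) (k := 2 * π) (φ := fun s => (b s : ℂ)) φ.integrable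
      (fun s hs => by simp [hout s hs.le]) hconj
    exact this.congr (by norm_num)
      (fun t => by rw [Complex.mul_conj, Complex.normSq_eq_norm_sq])

end Prethermal
end

/-! ### Infinite sinc product with fast decay -/

noncomputable section
namespace Prethermal
open MeasureTheory Filter Topology

lemma one_sub_sinc_sq_le (x : ℝ) : 1 - Real.sinc x ^ 2 ≤ x ^ 2 := by
  have key : ∀ y : ℝ, 0 < y → 1 - Real.sinc y ≤ y ^ 2 / 6 := by
    intro y hy
    have h := Real.sin_gt_sub_cube hy
    rw [Real.sinc_of_ne_zero hy.ne', sub_le_iff_le_add, ← sub_le_iff_le_add', le_div_iff₀ hy]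
    nlinarith
  have h2 : 1 - Real.sinc x ≤ x ^ 2 / 6 := by
    rcases lt_trichotomy x 0 with hx | rfl | hx
    · have := key (-x) (by linarith)
      rwa [Real.sinc_neg, neg_sq] at this
    · simp
    · exact key x hx
  nlinarith [Real.sinc_le_one x, Real.neg_one_le_sinc x, sq_nonneg x]

/-- The widths of the factors in the infinite product of sinc functions. -/
def sincWidth (k : ℕ) : ℝ := 1 / (8 * 2 ^ (k + k ^ 2))

lemma sincWidth_pos (k : ℕ) : 0 < sincWidth k := by unfold sincWidth; positivity

/-- A sinc of width `a` to the power `n` adds `n a` to the band. With power `2 * 2^(k²)` the `k`-th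
factor adds `(1/2)^k / 4`, in total at most `1/2`, although the powers grow superexponentially. -/
lemma multiplicity_mul_sincWidth (k : ℕ) : (2 : ℝ) ^ k ^ 2 * sincWidth k = (1 / 2) ^ k / 8 := by
  unfold sincWidth
  rw [pow_add, one_div_pow]
  field_simp

lemma sincWidth_le_one (k : ℕ) : sincWidth k ≤ 1 := by
  have : (1 : ℝ) ≤ 2 ^ (k + k ^ 2) := one_le_pow₀ (by norm_num)
  unfold sincWidth
  rw [div_le_one (by positivity)]
  linarith

/-- The factors of the infinite product of sinc functions. -/
def sincFactor (k : ℕ) (t : ℝ) : ℝ := Real.sinc (sincWidth k * t) ^ (2 * 2 ^ k ^ 2)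

lemma sincFactor_nonneg (k : ℕ) (t : ℝ) : 0 ≤ sincFactor k t := by
  rw [sincFactor, pow_mul]; positivity

lemma sincFactor_le_one (k : ℕ) (t : ℝ) : sincFactor k t ≤ 1 := by
  rw [sincFactor, pow_mul]
  exact pow_le_one₀ (sq_nonneg _) ((sq_le_one_iff_abs_le_one _).2 (Real.abs_sinc_le_one _))

lemma continuous_sincFactor (k : ℕ) : Continuous (sincFactor k) := by
  unfold sincFactor; fun_prop

/-- Bernoulli's inequality applied to `(sinc²)^(2^(k²))`, with `1 - sinc² x ≤ x²`. The bound is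
summable in `k`, which makes the infinite product converge. -/
lemma one_sub_sincFactor_le (k : ℕ) (t : ℝ) : 1 - sincFactor k t ≤ (1 / 2) ^ k * t ^ 2 := by
  set x := sincWidth k * t with hx
  have h1 := one_sub_sinc_sq_le x
  have h2 := one_add_mul_le_pow (a := Real.sinc x ^ 2 - 1) (by nlinarith [sq_nonneg (Real.sinc x)])
    (2 ^ k ^ 2)
  rw [add_sub_cancel, ← pow_mul] at h2
  have h3 : (2 : ℝ) ^ k ^ 2 * x ^ 2 ≤ (1 / 2) ^ k * t ^ 2 := by
    rw [hx, mul_pow, ← mul_assoc]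
    refine mul_le_mul_of_nonneg_right ?_ (sq_nonneg t)
    rw [pow_two (sincWidth k), ← mul_assoc, multiplicity_mul_sincWidth]
    have : (0 : ℝ) < (1 / 2) ^ k := by positivity
    nlinarith [sincWidth_le_one k, sincWidth_pos k]
  have h4 : (0 : ℝ) < 2 ^ k ^ 2 := by positivity
  push_cast at h2
  unfold sincFactor
  rw [← hx]
  nlinarith

/-- The infinite product of sinc functions. -/
def sincProd (t : ℝ) : ℝ := ∏' k, sincFactor k t

/-- Weierstrass M-test on balls. Locally uniform convergence is needed for the continuity of the
limit, and that for the positivity of its integral against the base function. -/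
lemma hasProdLocallyUniformlyOn_sincFactor (R : ℝ) :
    HasProdLocallyUniformlyOn sincFactor sincProd (Metric.ball 0 R) := by
  have h := Summable.hasProdLocallyUniformlyOn_nat_one_add (f := fun k t => sincFactor k t - 1)
    (K := Metric.ball (0 : ℝ) R) (u := fun k => (1 / 2) ^ k * R ^ 2) Metric.isOpen_ball
    (summable_geometric_two.mul_right _)
    (Eventually.of_forall fun k t ht => ?_)
    (fun k => ((continuous_sincFactor k).sub continuous_const).continuousOn)
  · have e : sincProd = fun t => ∏' k, (1 + (sincFactor k t - 1)) := by
      funext t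
      simp [sincProd]
    rw [e]
    convert! h using 3
    simp
  · rw [mem_ball_zero_iff, Real.norm_eq_abs] at ht
    rw [Real.norm_eq_abs, abs_sub_comm, abs_of_nonneg (sub_nonneg.2 (sincFactor_le_one k t))]
    refine (one_sub_sincFactor_le k t).trans (mul_le_mul_of_nonneg_left ?_ (by positivity))
    rw [← sq_abs t]
    gcongr

lemma continuous_sincProd : Continuous sincProd := by
  rw [continuous_iff_continuousAt]
  intro t
  have h := (hasProdLocallyUniformlyOn_sincFactor (|t| + 1)).tendstoLocallyUniformlyOn_finsetRange
  have hc := h.continuousOn (Frequently.of_forall fun K =>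
    (continuous_finsetProd _ fun k _ => continuous_sincFactor k).continuousOn)
  exact hc.continuousAt (Metric.isOpen_ball.mem_nhds (by simp))

lemma tendsto_prod_sincFactor (t : ℝ) :
    Tendsto (fun K => ∏ k ∈ Finset.range K, sincFactor k t) atTop (𝓝 (sincProd t)) :=
  ((hasProdLocallyUniformlyOn_sincFactor (|t| + 1)).hasProd (by simp)).tendsto_prod_nat

lemma prod_sincFactor_nonneg (K : ℕ) (t : ℝ) : 0 ≤ ∏ k ∈ Finset.range K, sincFactor k t :=
  Finset.prod_nonneg fun k _ => sincFactor_nonneg k t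

lemma prod_sincFactor_le_one (K : ℕ) (t : ℝ) : ∏ k ∈ Finset.range K, sincFactor k t ≤ 1 :=
  Finset.prod_le_one (fun k _ => sincFactor_nonneg k t) fun k _ => sincFactor_le_one k t

lemma sincProd_nonneg (t : ℝ) : 0 ≤ sincProd t :=
  ge_of_tendsto' (tendsto_prod_sincFactor t) fun K => prod_sincFactor_nonneg K t

lemma sincProd_le_one (t : ℝ) : sincProd t ≤ 1 :=
  le_of_tendsto' (tendsto_prod_sincFactor t) fun K => prod_sincFactor_le_one K t

lemma sincProd_zero : sincProd 0 = 1 := by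
  simp [sincProd, sincFactor]

lemma sincProd_le_sincFactor (k : ℕ) (t : ℝ) : sincProd t ≤ sincFactor k t := by
  refine le_of_tendsto (tendsto_prod_sincFactor t) ?_
  filter_upwards [eventually_gt_atTop k] with K hK
  rw [← Finset.mul_prod_erase _ _ (Finset.mem_range.2 hK)]
  exact mul_le_of_le_one_right (sincFactor_nonneg k t)
    (Finset.prod_le_one (fun k _ => sincFactor_nonneg k t) fun k _ => sincFactor_le_one k t)

/-- The argument of the sinc has size at least `2` there, so `sinc² ≤ 1/4 ≤ e⁻¹`, and the factor is
the `2^(k²)`-th power of this square. -/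
lemma sincFactor_le_exp {k : ℕ} {t : ℝ} (h : 16 * 2 ^ (k + k ^ 2) ≤ |t|) :
    sincFactor k t ≤ Real.exp (-2 ^ k ^ 2) := by
  set x := sincWidth k * t with hx
  have h2 : 2 ≤ |x| := by
    rw [hx, abs_mul, abs_of_pos (sincWidth_pos k), sincWidth, one_div, inv_mul_eq_div,
      le_div_iff₀ (by positivity)]
    linarith
  have hx0 : x ≠ 0 := by rintro h0; rw [h0, abs_zero] at h2; linarith
  have h3 : Real.sinc x ^ 2 ≤ 1 / 4 := by
    rw [Real.sinc_of_ne_zero hx0, div_pow, div_le_iff₀ (by positivity)]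
    nlinarith [Real.sin_sq_le_one x, sq_abs x]
  have h4 : (1 / 4 : ℝ) ≤ Real.exp (-1) := by
    rw [Real.exp_neg, one_div]
    exact inv_anti₀ (Real.exp_pos _) (by linarith [Real.exp_one_lt_d9])
  calc sincFactor k t = (Real.sinc x ^ 2) ^ (2 ^ k ^ 2) := by rw [sincFactor, pow_mul]
    _ ≤ Real.exp (-1) ^ (2 ^ k ^ 2) := by gcongr; exact h3.trans h4
    _ = Real.exp (-2 ^ k ^ 2) := by rw [← Real.exp_nat_mul]; push_cast; congr 1; ring

/-- The exponent on the left is `α (k² + 3k + 2)` up to a constant, and `α < 1` makes it smaller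
than `k²` eventually; `B` absorbs the finitely many remaining `k`. -/
lemma exists_mul_rpow_le_two_pow {α : ℝ} (hα₁ : α < 1) (hα₀ : 0 < α) (c : ℝ) :
    ∃ B : ℝ, ∀ k : ℕ, c * (16 * 2 ^ ((k + 1) + (k + 1) ^ 2)) ^ α ≤ B + 2 ^ k ^ 2 := by
  obtain ⟨p, hp⟩ := pow_unbounded_of_one_lt (c * 16 ^ α) (one_lt_two (α := ℝ))
  have hev : ∀ᶠ k : ℕ in atTop,
      c * (16 * 2 ^ ((k + 1) + (k + 1) ^ 2)) ^ α - (2 : ℝ) ^ k ^ 2 ≤ 0 := by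
    filter_upwards [eventually_ge_atTop (⌈(5 + p) / (1 - α)⌉₊ + 1)] with k hk
    have hk1 : (1 : ℝ) ≤ k := by
      have : 1 ≤ k := by omega
      exact_mod_cast this
    have hk2 : (5 + p : ℝ) ≤ k * (1 - α) := by
      rw [← div_le_iff₀ (by linarith)]
      exact (Nat.le_ceil _).trans (by exact_mod_cast (by omega : ⌈(5 + p) / (1 - α)⌉₊ ≤ k))
    rw [Real.mul_rpow (by norm_num) (by positivity), ← mul_assoc, sub_nonpos]
    have e1 : ((2 : ℝ) ^ ((k + 1) + (k + 1) ^ 2)) ^ α = 2 ^ (α * (k ^ 2 + 3 * k + 2)) := by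
      rw [← Real.rpow_natCast, ← Real.rpow_mul (by norm_num)]
      congr 1; push_cast; ring
    have e2 : (2 : ℝ) ^ k ^ 2 = 2 ^ ((k : ℝ) ^ 2) := by
      rw [← Real.rpow_natCast]; push_cast; rfl
    have e3 : (2 : ℝ) ^ p = 2 ^ (p : ℝ) := (Real.rpow_natCast _ _).symm
    rw [e1, e2]
    calc c * 16 ^ α * 2 ^ (α * (k ^ 2 + 3 * k + 2) : ℝ)
        ≤ 2 ^ (p : ℝ) * 2 ^ (α * (k ^ 2 + 3 * k + 2) : ℝ) := by
          rw [← e3]; gcongr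
      _ = 2 ^ (p + α * (k ^ 2 + 3 * k + 2) : ℝ) := (Real.rpow_add (by norm_num) _ _).symm
      _ ≤ 2 ^ ((k : ℝ) ^ 2) := by
          refine Real.rpow_le_rpow_of_exponent_le (by norm_num) ?_
          have hp0 : (0 : ℝ) ≤ p := by positivity
          have h5 : α * (3 * k + 2) ≤ 5 * k := by nlinarith
          nlinarith [mul_le_mul_of_nonneg_left hk2 (by linarith : (0 : ℝ) ≤ k),
            mul_le_mul_of_nonneg_left hk1 hp0]
  obtain ⟨B, hB⟩ := (isBoundedUnder_of_eventually_le hev).bddAbove_range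
  exact ⟨B, fun k => by have := hB ⟨k, rfl⟩; linarith⟩

/-- Each `|t| ≥ 16` lies in a window `16 * 2^(k+k²) ≤ |t| < 16 * 2^((k+1)+(k+1)²)`. There the `k`-th
factor alone is at most `exp(-2^(k²))`, which beats `exp(c |t|^α)` taken at the right end of the
window. -/
lemma exists_sincProd_mul_exp_le {α : ℝ} (hα₀ : 0 < α) (hα₁ : α < 1) {c : ℝ} (hc : 0 ≤ c) :
    ∃ C : ℝ, 0 ≤ C ∧ ∀ t, sincProd t * Real.exp (c * |t| ^ α) ≤ C := by
  obtain ⟨B, hB⟩ := exists_mul_rpow_le_two_pow hα₁ hα₀ c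
  refine ⟨Real.exp (max B (c * 16 ^ α)), (Real.exp_pos _).le, fun t => ?_⟩
  by_cases ht : |t| < 16
  · calc sincProd t * Real.exp (c * |t| ^ α) ≤ 1 * Real.exp (c * |t| ^ α) := by
          gcongr; exact sincProd_le_one t
      _ ≤ _ := by
          rw [one_mul]
          refine Real.exp_le_exp.2 (le_trans ?_ (le_max_right _ _))
          gcongr
  · have hex : ∃ k : ℕ, |t| < 16 * 2 ^ ((k + 1) + (k + 1) ^ 2) := by
      obtain ⟨p, hp⟩ := pow_unbounded_of_one_lt |t| (one_lt_two (α := ℝ))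
      refine ⟨p, hp.trans_le ?_⟩
      have : (2 : ℝ) ^ p ≤ 2 ^ ((p + 1) + (p + 1) ^ 2) :=
        pow_le_pow_right₀ (by norm_num) (by omega)
      linarith [show (0 : ℝ) < 2 ^ p by positivity]
    classical
    have hk1 := Nat.find_spec hex
    set k := Nat.find hex with hk
    have hk2 : 16 * 2 ^ (k + k ^ 2) ≤ |t| := by
      rcases Nat.eq_zero_or_pos k with h0 | hpos
      · rw [h0]; simpa using not_lt.1 ht
      · have := Nat.find_min hex (m := k - 1) (by omega)
        rw [Nat.sub_add_cancel hpos] at this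
        exact not_lt.1 this
    calc sincProd t * Real.exp (c * |t| ^ α)
        ≤ Real.exp (-2 ^ k ^ 2) * Real.exp (c * (16 * 2 ^ ((k + 1) + (k + 1) ^ 2)) ^ α) := by
          refine mul_le_mul ((sincProd_le_sincFactor k t).trans (sincFactor_le_exp hk2)) ?_
            (Real.exp_pos _).le (Real.exp_pos _).le
          gcongr
      _ = Real.exp (-2 ^ k ^ 2 + c * (16 * 2 ^ ((k + 1) + (k + 1) ^ 2)) ^ α) :=
          (Real.exp_add _ _).symm
      _ ≤ _ := Real.exp_le_exp.2 (le_trans (by linarith [hB k]) (le_max_left _ _))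

/-- There is a continuous, normalised, band-limited function that decays faster than every
stretched exponential. -/
lemma exists_bandLimited_filter : ∃ w : ℝ → ℝ, Continuous w ∧ (∀ t, 0 ≤ w t) ∧ ∫ t, w t = 1 ∧
    HasBand 1 (fun t => (w t : ℂ)) ∧
    ∀ α : ℝ, 0 < α → α < 1 → ∀ c : ℝ, 0 ≤ c →
      Integrable fun t => w t * Real.exp (c * |t| ^ α) := by
  obtain ⟨f, hfc, hf0, hfpos, hfb⟩ := exists_hasBand_base
  have hfi : Integrable f := hfb.1.re
  -- The base function uses half of the band and the sinc factors together at most the other half.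
  have hband : HasBand 1 fun t => (f t : ℂ) * (sincProd t : ℂ) := by
    refine HasBand.of_tendsto hfb.1
      (m := fun K t => ((∏ k ∈ Finset.range K, sincFactor k t : ℝ) : ℂ)) (fun K => ?_)
      (fun K t => ?_) (fun t => ?_)
    · refine HasBand.mono (hfb.mul_prod_sinc_pow (fun k => (sincWidth_pos k).le)
        (fun k => 2 * 2 ^ k ^ 2) K) ?_
      have : ∑ k ∈ Finset.range K, ((2 * 2 ^ k ^ 2 : ℕ) : ℝ) * sincWidth k =
          1 / 4 * ∑ k ∈ Finset.range K, (1 / 2 : ℝ) ^ k := by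
        rw [Finset.mul_sum]
        refine Finset.sum_congr rfl fun k _ => ?_
        push_cast
        rw [mul_assoc, multiplicity_mul_sincWidth]; ring
      rw [this]
      have := summable_geometric_two.sum_le_tsum (Finset.range K) (fun k _ => by positivity)
      rw [tsum_geometric_two] at this
      linarith
    · rw [Complex.norm_real, Real.norm_eq_abs, abs_of_nonneg (prod_sincFactor_nonneg K t)]
      exact prod_sincFactor_le_one K t
    · exact (Complex.continuous_ofReal.tendsto _).comp (tendsto_prod_sincFactor t)
  have hgc : Continuous fun t => f t * sincProd t := hfc.mul continuous_sincProd
  have hg0 : ∀ t, 0 ≤ f t * sincProd t := fun t => mul_nonneg (hf0 t) (sincProd_nonneg t)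
  have hgi : Integrable fun t => f t * sincProd t := by
    have := hband.1.re
    simpa using this
  have hZ : 0 < ∫ t, f t * sincProd t := by
    rw [integral_pos_iff_support_of_nonneg hg0 hgi]
    refine hgc.isOpen_support.measure_pos _ ⟨0, ?_⟩
    simp [sincProd_zero, hfpos.ne']
  set Z := ∫ t, f t * sincProd t
  refine ⟨fun t => Z⁻¹ * (f t * sincProd t), by fun_prop, fun t => mul_nonneg (by positivity) (hg0 t),
    ?_, ⟨?_, fun y hy => ?_⟩, fun α hα₀ hα₁ c hc => ?_⟩
  · rw [integral_const_mul, inv_mul_cancel₀ hZ.ne']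
  · exact (hgi.const_mul _).ofReal
  · have := hband.2 y hy
    rw [← mul_zero (Z⁻¹ : ℂ), ← this, ← integral_const_mul]
    congr 1; ext t; push_cast; ring
  · obtain ⟨C, hC0, hC⟩ := exists_sincProd_mul_exp_le hα₀ hα₁ hc
    refine (hfi.mul_const (Z⁻¹ * C)).mono' ?_ (Eventually.of_forall fun t => ?_)
    · refine Continuous.aestronglyMeasurable ?_
      have : Continuous fun t : ℝ => |t| ^ α :=
        continuous_abs.rpow_const fun t => Or.inr hα₀.le
      fun_prop
    · have h1 : 0 ≤ Z⁻¹ * (f t * sincProd t) * Real.exp (c * |t| ^ α) :=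
        mul_nonneg (mul_nonneg (by positivity) (hg0 t)) (Real.exp_pos _).le
      rw [Real.norm_eq_abs, abs_of_nonneg h1]
      calc _ = f t * (Z⁻¹ * (sincProd t * Real.exp (c * |t| ^ α))) := by ring
        _ ≤ f t * (Z⁻¹ * C) := by
          have := hf0 t
          gcongr
          exact hC t

end Prethermal
end

/-! ### The pair of filter functions -/

noncomputable section
namespace Prethermal
open MeasureTheory Filter Topology

/-- `w` is a band-limited filter function and `W` is minus its primitive vanishing at infinity,
with a unit jump at the origin. -/
structure IsFilterPair (Δ : ℝ) (w W : ℝ → ℝ) : Prop where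
  integrable_fst : Integrable w
  integrable_snd : Integrable W
  band : HasBand Δ fun t => (w t : ℂ)
  exists_primitive : ∃ F : ℝ → ℝ, (∀ t, HasDerivAt F (w t) t) ∧ (∀ t, t ≤ 0 → W t = -F t) ∧
    ∀ t, 0 < t → W t = 1 - F t
  tendsto_atTop : Tendsto W atTop (𝓝 0)
  tendsto_atBot : Tendsto W atBot (𝓝 0)

lemma integrable_exp_neg_abs_rpow {α : ℝ} (hα : 0 < α) :
    Integrable fun t : ℝ => Real.exp (-|t| ^ α) := by
  have h := integrableOn_rpow_mul_exp_neg_rpow (p := α) (s := 0) (by norm_num) hα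
  simp only [Real.rpow_zero, one_mul] at h
  have h1 : IntegrableOn (fun t : ℝ => Real.exp (-|t| ^ α)) (Set.Ioi 0) :=
    h.congr_fun (fun t ht => by rw [abs_of_pos ht]) measurableSet_Ioi
  have h2 : IntegrableOn (fun t : ℝ => Real.exp (-|t| ^ α)) (Set.Iio 0) := by
    have := h1.comp_neg
    simpa using this
  rw [← integrableOn_univ, ← Set.Iic_union_Ioi (a := (0 : ℝ))]
  exact ((integrableOn_Iic_iff_integrableOn_Iio).2 h2).union h1

lemma continuous_abs_rpow {α : ℝ} (hα : 0 ≤ α) : Continuous fun t : ℝ => |t| ^ α :=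
  continuous_abs.rpow_const fun _ => Or.inr hα

/-- Minus the primitive of `w`, vanishing at infinity. -/
def filterTail (w : ℝ → ℝ) (t : ℝ) : ℝ := (if 0 < t then 1 else 0) - ∫ s in Set.Iic t, w s

/-- On either side of the origin `filterTail` is, up to sign, the integral of `w` over points with
`|s| ≥ |t|`; for `t > 0` this uses `∫ w = 1`. Markov's inequality with weight `exp(c |s|^α)` then
applies. -/
lemma abs_filterTail_mul_exp_le {w : ℝ → ℝ} (hw0 : ∀ t, 0 ≤ w t) (hw : Integrable w)
    (hw1 : ∫ t, w t = 1) {α c : ℝ} (hα : 0 < α) (hc : 0 ≤ c)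
    (hint : Integrable fun t => w t * Real.exp (c * |t| ^ α)) (t : ℝ) :
    |filterTail w t| ≤ (∫ s, w s * Real.exp (c * |s| ^ α)) * Real.exp (-(c * |t| ^ α)) := by
  have key : ∀ A : Set ℝ, MeasurableSet A → (∀ s ∈ A, |t| ≤ |s|) → |∫ s in A, w s| ≤
      (∫ s, w s * Real.exp (c * |s| ^ α)) * Real.exp (-(c * |t| ^ α)) := by
    intro A hA hAt
    rw [abs_of_nonneg (setIntegral_nonneg hA fun s _ => hw0 s), ← integral_mul_const]
    calc ∫ s in A, w s ≤ ∫ s in A, w s * Real.exp (c * |s| ^ α) * Real.exp (-(c * |t| ^ α)) := by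
          refine setIntegral_mono_on hw.integrableOn (hint.mul_const _).integrableOn hA ?_
          intro s hs
          rw [mul_assoc, ← Real.exp_add]
          refine le_mul_of_one_le_right (hw0 s) (Real.one_le_exp ?_)
          have : |t| ^ α ≤ |s| ^ α := Real.rpow_le_rpow (abs_nonneg _) (hAt s hs) hα.le
          nlinarith
      _ ≤ _ := setIntegral_le_integral (hint.mul_const _) (Eventually.of_forall fun s =>
          mul_nonneg (mul_nonneg (hw0 s) (Real.exp_pos _).le) (Real.exp_pos _).le)
  unfold filterTail
  split_ifs with ht
  · rw [← hw1, ← integral_add_compl (measurableSet_Iic (a := t)) hw, add_sub_cancel_left,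
      Set.compl_Iic]
    refine key _ measurableSet_Ioi fun s hs => ?_
    rw [abs_of_pos ht, abs_of_pos (ht.trans hs)]
    exact le_of_lt hs
  · rw [zero_sub, abs_neg]
    refine key _ measurableSet_Iic fun s hs => ?_
    have hs' : s ≤ t := hs
    rw [abs_of_nonpos (not_lt.1 ht), abs_of_nonpos (hs'.trans (not_lt.1 ht))]
    linarith

lemma hasDerivAt_integral_Iic {w : ℝ → ℝ} (hc : Continuous w) (hw : Integrable w) (t : ℝ) :
    HasDerivAt (fun t => ∫ s in Set.Iic t, w s) (w t) t := by
  have h : ∀ u, ∫ s in Set.Iic u, w s = (∫ s in Set.Iic 0, w s) + ∫ s in (0 : ℝ)..u, w s :=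
    fun u => by
      rw [← intervalIntegral.integral_Iic_sub_Iic hw.integrableOn hw.integrableOn]; ring
  have e : (fun t => ∫ s in Set.Iic t, w s) = fun u =>
      (∫ s in Set.Iic 0, w s) + ∫ s in (0 : ℝ)..u, w s := funext h
  rw [e]
  exact (hc.integral_hasStrictDerivAt 0 t).hasDerivAt.const_add _

lemma measurable_filterTail {w : ℝ → ℝ} (hc : Continuous w) (hw : Integrable w) :
    Measurable (filterTail w) := by
  unfold filterTail
  refine (Measurable.ite measurableSet_Ioi measurable_const measurable_const).sub ?_
  exact Continuous.measurable (continuous_iff_continuousAt.2 fun t =>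
    (hasDerivAt_integral_Iic hc hw t).continuousAt)

/-- Filter functions with tails decaying faster than every stretched exponential. -/
theorem exists_isFilterPair : ∃ w W : ℝ → ℝ → ℝ, (∀ Δ, 0 < Δ → IsFilterPair Δ (w Δ) (W Δ)) ∧
    ∀ α : ℝ, 0 < α → α < 1 → ∀ c : ℝ, 0 ≤ c → ∃ M : ℝ, 0 ≤ M ∧ ∀ Δ, 0 < Δ →
      (Integrable (fun t => |w Δ t| * Real.exp (c * (Δ * |t|) ^ α)) ∧
        ∫ t, |w Δ t| * Real.exp (c * (Δ * |t|) ^ α) ≤ M) ∧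
      (Integrable (fun t => |W Δ t| * Real.exp (c * (Δ * |t|) ^ α)) ∧
        ∫ t, |W Δ t| * Real.exp (c * (Δ * |t|) ^ α) ≤ M / Δ) := by
  obtain ⟨w, hwc, hw0, hw1, hwb, hwe⟩ := exists_bandLimited_filter
  have hw : Integrable w := by simpa using hwb.1.re
  have htail : ∀ α : ℝ, 0 < α → α < 1 → ∀ c : ℝ, 0 ≤ c →
      Integrable fun t => |filterTail w t| * Real.exp (c * |t| ^ α) := by
    intro α hα₀ hα₁ c hc
    -- Apply the tail bound with `c + 1` in place of `c`; the surplus `exp(-|t|^α)` gives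
    -- integrability.
    refine ((integrable_exp_neg_abs_rpow hα₀).const_mul
      (∫ s, w s * Real.exp ((c + 1) * |s| ^ α))).mono' ?_ (Eventually.of_forall fun t => ?_)
    · refine (measurable_filterTail hwc hw).aestronglyMeasurable.norm.mul ?_
      have := continuous_abs_rpow hα₀.le
      exact Continuous.aestronglyMeasurable (by fun_prop)
    · rw [Real.norm_eq_abs, abs_of_nonneg (by positivity)]
      have := abs_filterTail_mul_exp_le hw0 hw hw1 hα₀ (by linarith : (0 : ℝ) ≤ c + 1)
        (hwe α hα₀ hα₁ (c + 1) (by linarith)) t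
      calc _ ≤ (∫ s, w s * Real.exp ((c + 1) * |s| ^ α)) * Real.exp (-((c + 1) * |t| ^ α)) *
            Real.exp (c * |t| ^ α) := by gcongr
        _ = _ := by
          rw [mul_assoc, ← Real.exp_add]; congr 2; ring
  have htailI : Integrable (filterTail w) := by
    refine (htail (1 / 2) (by norm_num) (by norm_num) 0 le_rfl).mono
      (measurable_filterTail hwc hw).aestronglyMeasurable (Eventually.of_forall fun t => ?_)
    simp
  have hlim : ∀ l : Filter ℝ, Tendsto (fun t : ℝ => |t|) l atTop →
      Tendsto (filterTail w) l (𝓝 0) := by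
    intro l hl
    have h1 : Tendsto (fun t : ℝ => Real.exp (-(1 * |t| ^ (1 / 2 : ℝ)))) l (𝓝 0) := by
      simp only [one_mul]
      exact Real.tendsto_exp_neg_atTop_nhds_zero.comp
        ((tendsto_rpow_atTop (by norm_num : (0 : ℝ) < 1 / 2)).comp hl)
    have h2 := h1.const_mul (∫ s, w s * Real.exp (1 * |s| ^ (1 / 2 : ℝ)))
    rw [mul_zero] at h2
    refine squeeze_zero_norm (fun t => ?_) h2
    have := abs_filterTail_mul_exp_le hw0 hw hw1 (α := 1 / 2) (c := 1) (by norm_num) zero_le_one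
      (hwe _ (by norm_num) (by norm_num) 1 zero_le_one) t
    exact this
  -- Rescaling time by `Δ` preserves the integral of `w`; its primitive is not multiplied by `Δ`, so
  -- its weighted integral scales like `1/Δ`, the source of that factor in the bound for `𝔸`.
  refine ⟨fun Δ t => Δ * w (Δ * t), fun Δ t => filterTail w (Δ * t), fun Δ hΔ => ?_,
    fun α hα₀ hα₁ c hc => ?_⟩
  · refine ⟨(hw.comp_mul_left' hΔ.ne').const_mul _, htailI.comp_mul_left' hΔ.ne',
      ⟨((hw.comp_mul_left' hΔ.ne').const_mul _).ofReal, fun y hy => ?_⟩,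
      ⟨fun t => ∫ s in Set.Iic (Δ * t), w s, fun t => ?_, fun t ht => ?_, fun t ht => ?_⟩, ?_, ?_⟩
    · have h1 : ∀ t : ℝ, Complex.exp ((y * t : ℝ) * Complex.I) * ((Δ * w (Δ * t) : ℝ) : ℂ) =
          Δ * (fun s : ℝ => Complex.exp ((y / Δ * s : ℝ) * Complex.I) * (w s : ℂ)) (Δ * t) := by
        intro t
        have : y / Δ * (Δ * t) = y * t := by field_simp
        simp only [this]
        push_cast; ring
      simp_rw [h1]
      rw [integral_const_mul, Measure.integral_comp_mul_left
        (fun s : ℝ => Complex.exp ((y / Δ * s : ℝ) * Complex.I) * (w s : ℂ)), hwb.2 (y / Δ)]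
      · simp
      · rw [abs_div, abs_of_pos hΔ, le_div_iff₀ hΔ, one_mul]; exact hy
    · have := (hasDerivAt_integral_Iic hwc hw (Δ * t)).comp t ((hasDerivAt_id t).const_mul Δ)
      simpa [mul_comm, Function.comp_def] using this
    · simp [filterTail, not_lt.2 (mul_nonpos_of_nonneg_of_nonpos hΔ.le ht)]
    · simp [filterTail, mul_pos hΔ ht]
    · exact (hlim _ tendsto_abs_atTop_atTop).comp (tendsto_id.const_mul_atTop hΔ)
    · exact (hlim _ tendsto_abs_atBot_atTop).comp (tendsto_id.const_mul_atBot hΔ)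
  · refine ⟨max (∫ t, w t * Real.exp (c * |t| ^ α))
      (∫ t, |filterTail w t| * Real.exp (c * |t| ^ α)),
      le_max_of_le_left (integral_nonneg fun t => mul_nonneg (hw0 t) (Real.exp_pos _).le),
      fun Δ hΔ => ⟨?_, ?_⟩⟩
    · have h1 : ∀ t : ℝ, |Δ * w (Δ * t)| * Real.exp (c * (Δ * |t|) ^ α) =
          Δ * (fun s => w s * Real.exp (c * |s| ^ α)) (Δ * t) := by
        intro t
        simp only [abs_mul, abs_of_pos hΔ, abs_of_nonneg (hw0 _)]
        ring
      simp_rw [h1]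
      refine ⟨((hwe α hα₀ hα₁ c hc).comp_mul_left' hΔ.ne').const_mul _, ?_⟩
      rw [integral_const_mul, Measure.integral_comp_mul_left
        (fun s => w s * Real.exp (c * |s| ^ α)), abs_of_pos (inv_pos.2 hΔ), smul_eq_mul,
        mul_inv_cancel_left₀ hΔ.ne']
      exact le_max_left _ _
    · have h1 : ∀ t : ℝ, |filterTail w (Δ * t)| * Real.exp (c * (Δ * |t|) ^ α) =
          (fun s => |filterTail w s| * Real.exp (c * |s| ^ α)) (Δ * t) := by
        intro t
        simp only [abs_mul, abs_of_pos hΔ]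
      simp_rw [h1]
      refine ⟨(htail α hα₀ hα₁ c hc).comp_mul_left' hΔ.ne', ?_⟩
      rw [Measure.integral_comp_mul_left
        (fun s => |filterTail w s| * Real.exp (c * |s| ^ α)), abs_of_pos (inv_pos.2 hΔ), smul_eq_mul,
        inv_mul_eq_div]
      gcongr
      exact le_max_right _ _

end Prethermal
end

/-! ### Heisenberg evolution and its time averages -/

noncomputable section
namespace Prethermal
open MeasureTheory Filter Topology

section Evolution

variable {𝔸 : Type*} [NormedRing 𝔸] [NormedAlgebra ℂ 𝔸]

lemma liouvillian_apply (H O : 𝔸) : liouvillian H O = Complex.I • (H * O - O * H) := by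
  simp [liouvillian]

lemma evolution_zero (H O : 𝔸) : evolution H 0 O = O := by
  have h : ((0 : ℝ) : ℂ) • liouvillian H = 0 := by ext; simp
  rw [evolution, h, NormedSpace.exp_zero]
  rfl

lemma hasDerivAt_exp_real_smul [CompleteSpace 𝔸] (x : 𝔸) (t : ℝ) :
    HasDerivAt (fun t : ℝ => NormedSpace.exp ((t : ℂ) • x)) (NormedSpace.exp ((t : ℂ) • x) * x) t :=
  ((hasDerivAt_exp_smul_const (𝕂 := ℂ) x (t : ℂ)).scomp t
    Complex.ofRealCLM.hasDerivAt).congr_deriv (one_smul ℂ _)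

lemma hasDerivAt_exp_real_smul' [CompleteSpace 𝔸] (x : 𝔸) (t : ℝ) :
    HasDerivAt (fun t : ℝ => NormedSpace.exp ((t : ℂ) • x)) (x * NormedSpace.exp ((t : ℂ) • x)) t :=
  ((hasDerivAt_exp_smul_const' (𝕂 := ℂ) x (t : ℂ)).scomp t
    Complex.ofRealCLM.hasDerivAt).congr_deriv (one_smul ℂ _)

lemma hasDerivAt_evolution [CompleteSpace 𝔸] (H O : 𝔸) (t : ℝ) :
    HasDerivAt (fun t : ℝ => evolution H t O) (liouvillian H (evolution H t O)) t := by
  have h : HasDerivAt (fun t : ℝ => evolution H t) (liouvillian H * evolution H t) t :=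
    hasDerivAt_exp_real_smul' (liouvillian H) t
  let L : (𝔸 →L[ℂ] 𝔸) →L[ℝ] 𝔸 := (ContinuousLinearMap.apply ℂ 𝔸 O).restrictScalars ℝ
  exact L.hasFDerivAt.comp_hasDerivAt t h

lemma hasDerivAt_clm_evolution [CompleteSpace 𝔸] {F : Type*} [NormedAddCommGroup F]
    [NormedSpace ℂ F] (L : 𝔸 →L[ℂ] F) (H O : 𝔸) (t : ℝ) :
    HasDerivAt (fun t : ℝ => L (evolution H t O)) (L (liouvillian H (evolution H t O))) t :=
  (L.restrictScalars ℝ).hasFDerivAt.comp_hasDerivAt t (hasDerivAt_evolution H O t)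

lemma continuous_evolution [CompleteSpace 𝔸] (H O : 𝔸) : Continuous fun t => evolution H t O :=
  continuous_iff_continuousAt.2 fun t => (hasDerivAt_evolution H O t).continuousAt

/-- The derivative of the left side in `t` vanishes. So the exponential of the Liouvillian is
conjugation by `exp(i t H)`, which makes it isometric for self-adjoint `H`. -/
lemma exp_mul_evolution_mul_exp [CompleteSpace 𝔸] (H O : 𝔸) (t : ℝ) :
    NormedSpace.exp ((t : ℂ) • (-(Complex.I • H))) * evolution H t O *
      NormedSpace.exp ((t : ℂ) • (Complex.I • H)) = O := by
  set f : ℝ → 𝔸 := fun t => NormedSpace.exp ((t : ℂ) • (-(Complex.I • H))) * evolution H t O *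
      NormedSpace.exp ((t : ℂ) • (Complex.I • H)) with hf
  have hd : ∀ s, HasDerivAt f 0 s := by
    intro s
    have h := ((hasDerivAt_exp_real_smul (-(Complex.I • H)) s).mul (hasDerivAt_evolution H O s)).mul
      (hasDerivAt_exp_real_smul' (Complex.I • H) s)
    refine h.congr_deriv ?_
    rw [liouvillian_apply]
    simp only [Pi.mul_apply, smul_mul_assoc, mul_smul_comm, mul_sub, sub_mul, mul_neg, neg_mul, add_mul,
      smul_sub, mul_assoc]
    abel
  have h0 : f t = f 0 := is_const_of_deriv_eq_zero (fun s => (hd s).differentiableAt)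
    (fun s => (hd s).deriv) t 0
  simpa [hf, evolution_zero] using h0

lemma norm_evolution [CompleteSpace 𝔸] [StarRing 𝔸] [CStarRing 𝔸] [StarModule ℂ 𝔸] {H : 𝔸}
    (hH : IsSelfAdjoint H) (t : ℝ) (O : 𝔸) : ‖evolution H t O‖ = ‖O‖ := by
  have hs : ∀ t : ℝ, (t : ℂ) • (Complex.I • H) ∈ skewAdjoint 𝔸 := by
    intro t
    rw [skewAdjoint.mem_iff, star_smul, star_smul, hH.star_eq]
    simp
  let _ : NormedAlgebra ℚ 𝔸 := NormedAlgebra.restrictScalars ℚ ℂ 𝔸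
  have h1 := NormedSpace.exp_mem_unitary_of_mem_skewAdjoint (hs t)
  have h2 := NormedSpace.exp_mem_unitary_of_mem_skewAdjoint (neg_mem (hs t))
  rw [← smul_neg] at h2
  conv_rhs => rw [← exp_mul_evolution_mul_exp H O t]
  rw [CStarRing.norm_mul_mem_unitary _ h1, CStarRing.norm_mem_unitary_mul _ h2]

lemma hasDerivAt_primitive_smul_evolution [CompleteSpace 𝔸] {F : ℝ → ℝ} {F' t : ℝ}
    (hF : HasDerivAt F F' t) (H O : 𝔸) :
    HasDerivAt (fun t => (F t : ℂ) • evolution H t O)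
      ((F t : ℂ) • liouvillian H (evolution H t O) + (F' : ℂ) • evolution H t O) t :=
  hF.ofReal_comp.smul (hasDerivAt_evolution H O t)

/-- The time average `∫ v(t) e^{t 𝓛₀} O dt` of the evolved operator, with weight `v`. -/
def weightedEvolution (v : ℝ → ℂ) (H O : 𝔸) : 𝔸 := ∫ t : ℝ, v t • evolution H t O

variable [CompleteSpace 𝔸] [StarRing 𝔸] [CStarRing 𝔸] [StarModule ℂ 𝔸] {H : 𝔸}

lemma integrable_smul_evolution (hH : IsSelfAdjoint H) {v : ℝ → ℂ} (hv : Integrable v) (O : 𝔸) :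
    Integrable fun t => v t • evolution H t O := by
  have := hv.norm.mul_const ‖O‖
  have hb : ∀ᵐ t : ℝ, ‖v t • evolution H t O‖ ≤ ‖v t‖ * ‖O‖ :=
    Eventually.of_forall fun t => by rw [norm_smul, norm_evolution hH]
  exact this.mono' (hv.aestronglyMeasurable.smul
    (continuous_evolution H O).aestronglyMeasurable) hb

lemma norm_weightedEvolution_le (hH : IsSelfAdjoint H) (v : ℝ → ℂ) (O : 𝔸) :
    ‖weightedEvolution v H O‖ ≤ (∫ t, ‖v t‖) * ‖O‖ := by
  rw [← integral_mul_const]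
  refine (norm_integral_le_integral_norm _).trans_eq ?_
  congr 1; ext t
  rw [norm_smul, norm_evolution hH]

lemma weightedEvolution_sum (hH : IsSelfAdjoint H) {v : ℝ → ℂ} (hv : Integrable v) {ι : Type*}
    (s : Finset ι) (f : ι → 𝔸) :
    weightedEvolution v H (∑ i ∈ s, f i) = ∑ i ∈ s, weightedEvolution v H (f i) := by
  unfold weightedEvolution
  rw [← integral_finsetSum _ fun i _ => integrable_smul_evolution hH hv (f i)]
  congr 1; ext t
  rw [map_sum, Finset.smul_sum]

lemma lie_weightedEvolution (hH : IsSelfAdjoint H) {v : ℝ → ℂ} (hv : Integrable v) (O B : 𝔸) :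
    ⁅weightedEvolution v H O, B⁆ = ∫ t, v t • ⁅evolution H t O, B⁆ := by
  have hi := integrable_smul_evolution hH hv O
  unfold weightedEvolution
  rw [Ring.lie_def, ← integral_mul_const_of_integrable hi, ← integral_const_mul_of_integrable hi,
    ← integral_sub (hi.mul_const B) (hi.const_mul B)]
  congr 1; ext t
  rw [Ring.lie_def, smul_mul_assoc, mul_smul_comm, smul_sub]

lemma norm_lie_weightedEvolution_le (hH : IsSelfAdjoint H) {v : ℝ → ℂ} (hv : Integrable v)
    {O B : 𝔸} {g : ℝ → ℝ} (hg : Integrable fun t => ‖v t‖ * g t)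
    (hbd : ∀ t, ‖⁅evolution H t O, B⁆‖ ≤ g t) :
    ‖⁅weightedEvolution v H O, B⁆‖ ≤ ∫ t, ‖v t‖ * g t := by
  rw [lie_weightedEvolution hH hv]
  refine norm_integral_le_of_norm_le hg (Eventually.of_forall fun t => ?_)
  rw [norm_smul]
  exact mul_le_mul_of_nonneg_left (hbd t) (norm_nonneg _)

lemma tendsto_smul_evolution (hH : IsSelfAdjoint H) {F : ℝ → ℝ} {l : Filter ℝ}
    (hF : Tendsto F l (𝓝 0)) (O : 𝔸) :
    Tendsto (fun t => (F t : ℂ) • evolution H t O) l (𝓝 0) := by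
  rw [tendsto_zero_iff_norm_tendsto_zero]
  have : ∀ t, ‖(F t : ℂ) • evolution H t O‖ = ‖F t‖ * ‖O‖ := fun t => by
    rw [norm_smul, norm_evolution hH, Complex.norm_real]
  simp_rw [this]
  simpa using hF.norm.mul_const ‖O‖

/-- Integrate the derivative of `W(t) • evolution H t O` over the two half-lines. The boundary terms
at infinity vanish because `W` does and the evolution is isometric; those at `0` are `-(1 - F 0) •
O` and `-F 0 • O`, whose sum is `-O`. -/
theorem lie_weightedEvolution_add (hH : IsSelfAdjoint H) {Δ : ℝ} {w W : ℝ → ℝ}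
    (h : IsFilterPair Δ w W) (O : 𝔸) :
    ⁅H, Complex.I • weightedEvolution (fun t => (W t : ℂ)) H O⁆ + O =
      weightedEvolution (fun t => (w t : ℂ)) H O := by
  obtain ⟨F, hF, hneg, hpos⟩ := h.exists_primitive
  have hwi : Integrable fun t => (w t : ℂ) • evolution H t O :=
    integrable_smul_evolution hH (h.integrable_fst.ofReal (𝕜 := ℂ)) O
  have hWi : Integrable fun t => (W t : ℂ) • evolution H t O :=
    integrable_smul_evolution hH (h.integrable_snd.ofReal (𝕜 := ℂ)) O
  have hLi : Integrable fun t => (W t : ℂ) • liouvillian H (evolution H t O) := by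
    simpa using (liouvillian H).integrable_comp hWi
  have hlie : ⁅H, Complex.I • weightedEvolution (fun t => (W t : ℂ)) H O⁆ =
      ∫ t, (W t : ℂ) • liouvillian H (evolution H t O) := by
    have := (liouvillian H).integral_comp_comm hWi
    simp only [map_smul] at this
    rw [this]
    simp only [weightedEvolution]
    rw [liouvillian_apply, Ring.lie_def, mul_smul_comm, smul_mul_assoc, smul_sub]
  set G' : ℝ → 𝔸 := fun t => (W t : ℂ) • liouvillian H (evolution H t O) +
    ((-w t : ℝ) : ℂ) • evolution H t O with hG'
  have hG'i : Integrable G' := by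
    refine hLi.add ?_
    simpa using hwi.neg
  have e1 : ∫ t in Set.Ioi 0, G' t = -(((1 - F 0 : ℝ) : ℂ) • O) := by
    have hd : ∀ t, HasDerivAt (fun t => 1 - F t) (-w t) t := fun t => (hF t).const_sub 1
    have h1 := integral_Ioi_of_hasDerivAt_of_tendsto' (a := (0 : ℝ)) (m := (0 : 𝔸))
      (f := fun t => ((1 - F t : ℝ) : ℂ) • evolution H t O)
      (f' := fun t => ((1 - F t : ℝ) : ℂ) • liouvillian H (evolution H t O) +
        ((-w t : ℝ) : ℂ) • evolution H t O)
      (fun t _ => hasDerivAt_primitive_smul_evolution (hd t) H O)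
      (hG'i.integrableOn.congr_fun (fun t ht => by rw [hG']; simp only [hpos t ht])
        measurableSet_Ioi)
      (tendsto_smul_evolution hH (h.tendsto_atTop.congr'
        ((eventually_gt_atTop 0).mono fun t ht => hpos t ht)) O)
    rw [evolution_zero, zero_sub] at h1
    rw [← h1]
    exact setIntegral_congr_fun measurableSet_Ioi fun t ht => by rw [hG']; simp only [hpos t ht]
  have e2 : ∫ t in Set.Iic 0, G' t = ((-F 0 : ℝ) : ℂ) • O := by
    have hd : ∀ t, HasDerivAt (fun t => -F t) (-w t) t := fun t => (hF t).neg
    have h1 := integral_Iic_of_hasDerivAt_of_tendsto' (a := (0 : ℝ)) (m := (0 : 𝔸))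
      (f := fun t => ((-F t : ℝ) : ℂ) • evolution H t O)
      (f' := fun t => ((-F t : ℝ) : ℂ) • liouvillian H (evolution H t O) +
        ((-w t : ℝ) : ℂ) • evolution H t O)
      (fun t _ => hasDerivAt_primitive_smul_evolution (hd t) H O)
      (hG'i.integrableOn.congr_fun (fun t ht => by rw [hG']; simp only [hneg t ht])
        measurableSet_Iic)
      (tendsto_smul_evolution hH (h.tendsto_atBot.congr'
        ((eventually_le_atBot 0).mono fun t ht => hneg t ht)) O)
    rw [evolution_zero, sub_zero] at h1
    rw [← h1]
    exact setIntegral_congr_fun measurableSet_Iic fun t ht => by rw [hG']; simp only [hneg t ht]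
  have e3 : ∫ t, G' t = (∫ t, (W t : ℂ) • liouvillian H (evolution H t O)) -
      weightedEvolution (fun t => (w t : ℂ)) H O := by
    rw [weightedEvolution, ← integral_sub hLi hwi]
    congr 1; ext t
    simp [hG', sub_eq_add_neg]
  have e4 : ∫ t, G' t = -O := by
    rw [← integral_add_compl measurableSet_Iic hG'i, Set.compl_Iic, e1, e2, ← neg_smul, ← add_smul]
    push_cast
    rw [show (-(F 0 : ℂ) + -(1 - (F 0 : ℂ))) = -1 by ring, neg_smul, one_smul]
  rw [hlie]
  rw [e4] at e3
  rw [sub_eq_iff_eq_add.1 e3.symm]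
  abel

end Evolution

/-! ### Matrix elements between eigenvectors -/

section Diagonal

variable {d : ℕ} {Λ : Finset (SimplicialLattice d)} {q : Λ → ℕ}

/-- The continuous linear functional `O ↦ ⟨ψ, O ψ'⟩`. -/
def matrixElement (ψ ψ' : HilbertSpace q) : Op q →L[ℂ] ℂ :=
  (innerSL ℂ ψ).comp (ContinuousLinearMap.apply ℂ (HilbertSpace q) ψ')

lemma matrixElement_apply (ψ ψ' : HilbertSpace q) (O : Op q) :
    matrixElement ψ ψ' O = inner ℂ ψ (O ψ') := rfl

/-- The matrix element solves `φ' = i (E - E') φ`: multiplied by the inverse phase it has zero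
derivative. -/
lemma inner_evolution_eigenvectors {H₀ : Op q} (hH : IsSelfAdjoint H₀) {E E' : ℝ}
    {ψ ψ' : HilbertSpace q} (hψ : H₀ ψ = (E : ℂ) • ψ) (hψ' : H₀ ψ' = (E' : ℂ) • ψ') (O : Op q)
    (t : ℝ) : inner ℂ ψ (evolution H₀ t O ψ') =
      Complex.exp (((E - E') * t : ℝ) * Complex.I) * inner ℂ ψ (O ψ') := by
  set φ : ℝ → ℂ := fun t => Complex.exp ((-((E - E') * t) : ℝ) * Complex.I) *
    inner ℂ ψ (evolution H₀ t O ψ') with hφ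
  have hd : ∀ s, HasDerivAt φ 0 s := by
    intro s
    have h1 : HasDerivAt (fun s => inner ℂ ψ (evolution H₀ s O ψ'))
        (inner ℂ ψ (liouvillian H₀ (evolution H₀ s O) ψ')) s :=
      hasDerivAt_clm_evolution (matrixElement ψ ψ') H₀ O s
    have h2 : inner ℂ ψ (liouvillian H₀ (evolution H₀ s O) ψ') =
        Complex.I * (E - E') * inner ℂ ψ (evolution H₀ s O ψ') := by
      have hadj : inner ℂ ψ (H₀ (evolution H₀ s O ψ')) = E * inner ℂ ψ (evolution H₀ s O ψ') := by
        rw [← ContinuousLinearMap.adjoint_inner_left, hH.adjoint_eq, hψ, inner_smul_left,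
          Complex.conj_ofReal]
      rw [liouvillian_apply]
      simp only [smul_apply, sub_apply,
        mul_apply_eq_comp, hψ', map_smul, inner_smul_right, inner_sub_right, hadj]
      ring
    have h3 : HasDerivAt (fun s : ℝ => Complex.exp ((-((E - E') * s) : ℝ) * Complex.I))
        (Complex.exp ((-((E - E') * s) : ℝ) * Complex.I) * (-(E - E') * Complex.I)) s := by
      have h4 : HasDerivAt (fun s : ℝ => ((-((E - E') * s) : ℝ) : ℂ) * Complex.I)
          (-(E - E') * Complex.I) s := by
        have := (((hasDerivAt_id s).const_mul (E - E')).neg.ofReal_comp).mul_const Complex.I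
        simpa using this
      exact h4.cexp
    have h5 := h3.mul h1
    rw [h2] at h5
    refine h5.congr_deriv ?_
    ring
  have h0 : φ t = φ 0 := is_const_of_deriv_eq_zero (fun s => (hd s).differentiableAt)
    (fun s => (hd s).deriv) t 0
  simp only [hφ, evolution_zero, mul_zero, neg_zero, Complex.ofReal_zero, zero_mul,
    Complex.exp_zero, one_mul] at h0
  rw [← h0, ← mul_assoc, ← Complex.exp_add]
  have : (((E - E') * t : ℝ) : ℂ) * Complex.I + ((-((E - E') * t) : ℝ) : ℂ) * Complex.I = 0 := by
    push_cast; ring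
  rw [this, Complex.exp_zero, one_mul]

theorem isDeltaDiagonal_superP {H₀ : Op q} (hH : IsSelfAdjoint H₀) {Δ : ℝ} {w : ℝ → ℝ}
    (hw : HasBand Δ fun t => (w t : ℂ)) (O : Op q) : IsDeltaDiagonal H₀ Δ (superP w H₀ O) := by
  intro E E' ψ ψ' hψ hψ' hE
  have hi := integrable_smul_evolution hH hw.1 O
  have h1 := (matrixElement ψ ψ').integral_comp_comm hi
  simp only [map_smul, matrixElement_apply, smul_eq_mul] at h1
  rw [superP, ← h1]
  simp_rw [inner_evolution_eigenvectors hH hψ hψ']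
  have h2 : ∀ t : ℝ, (w t : ℂ) * (Complex.exp (((E - E') * t : ℝ) * Complex.I) *
      inner ℂ ψ (O ψ')) = Complex.exp (((E - E') * t : ℝ) * Complex.I) * (w t : ℂ) *
        inner ℂ ψ (O ψ') := fun t => by ring
  simp_rw [h2]
  rw [integral_mul_const, hw.2 _ hE, zero_mul]

end Diagonal

end Prethermal
end

/-! ### Localising operators by a finite twirl -/

noncomputable section
namespace Prethermal

section Localization

variable {d : ℕ} {Λ : Finset (SimplicialLattice d)} {q : Λ → ℕ}

/-- Configurations of the sites in `Y`. -/
abbrev SubConfig (q : Λ → ℕ) (Y : Finset Λ) : Type := ∀ i : Y, Fin (q i)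

/-- A permutation of the configurations of `Y`, acting on all configurations. -/
def liftPerm (Y : Finset Λ) (σ : Equiv.Perm (SubConfig q Y)) : Equiv.Perm (Config q) :=
  (Equiv.piEquivPiSubtypeProd (· ∈ Y) fun i => Fin (q i)).trans
    ((σ.prodCongr (Equiv.refl _)).trans
      (Equiv.piEquivPiSubtypeProd (· ∈ Y) fun i => Fin (q i)).symm)

lemma liftPerm_restrict (Y : Finset Λ) (σ : Equiv.Perm (SubConfig q Y)) (c : Config q) :
    (fun i : Y => liftPerm Y σ c i) = σ fun i : Y => c i := by
  ext i
  simp [liftPerm, Equiv.piEquivPiSubtypeProd]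

lemma liftPerm_of_notMem {Y : Finset Λ} (σ : Equiv.Perm (SubConfig q Y)) (c : Config q) {i : Λ}
    (hi : i ∉ Y) : liftPerm Y σ c i = c i := by
  simp [liftPerm, Equiv.piEquivPiSubtypeProd, hi]

lemma config_ext {Y : Finset Λ} {c c' : Config q} (h : (fun i : Y => c i) = fun i : Y => c' i)
    (h' : ∀ i, i ∉ Y → c i = c' i) : c = c' := by
  funext i
  by_cases hi : i ∈ Y
  · exact congrFun h ⟨i, hi⟩
  · exact h' i hi

lemma liftPerm_mul (Y : Finset Λ) (σ τ : Equiv.Perm (SubConfig q Y)) (c : Config q) :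
    liftPerm Y (σ * τ) c = liftPerm Y σ (liftPerm Y τ c) := by
  refine config_ext (Y := Y) ?_ fun i hi => ?_
  · simp only [liftPerm_restrict, Equiv.Perm.mul_apply]
  · simp only [liftPerm_of_notMem _ _ hi]

/-- The signed permutation matrix on the configurations of `Y`. -/
def signedPerm {ι : Type*} [DecidableEq ι] (σ : Equiv.Perm ι) (ε : ι → ℤˣ) : Matrix ι ι ℂ :=
  Matrix.of fun k k' => if σ k = k' then ((ε k : ℤ) : ℂ) else 0

lemma signedPerm_mul_conjTranspose {ι : Type*} [Fintype ι] [DecidableEq ι] (σ : Equiv.Perm ι)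
    (ε : ι → ℤˣ) (M : Matrix ι ι ℂ) (c c' : ι) :
    (signedPerm σ ε * M * (signedPerm σ ε).conjTranspose) c c' =
      ((ε c : ℤ) : ℂ) * ((ε c' : ℤ) : ℂ) * M (σ c) (σ c') := by
  simp only [Matrix.mul_apply, signedPerm, Matrix.of_apply, Matrix.conjTranspose_apply, ite_mul,
    zero_mul, Finset.sum_ite_eq, Finset.mem_univ, if_true, apply_ite (star : ℂ → ℂ), star_zero,
    mul_ite, mul_zero]
  simp
  ring

lemma signedPerm_mem_unitary {ι : Type*} [Fintype ι] [DecidableEq ι] (σ : Equiv.Perm ι)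
    (ε : ι → ℤˣ) : signedPerm σ ε ∈ Matrix.unitaryGroup ι ℂ := by
  rw [Matrix.mem_unitaryGroup_iff]
  ext c c'
  have h := signedPerm_mul_conjTranspose σ ε 1 c c'
  rw [Matrix.mul_one] at h
  rw [Matrix.star_eq_conjTranspose, h]
  by_cases hc : c = c'
  · subst hc
    rw [Matrix.one_apply_eq, Matrix.one_apply_eq, mul_one]
    exact_mod_cast Int.units_coe_mul_self (ε c)
  · rw [Matrix.one_apply_ne hc, Matrix.one_apply_ne (by simpa using hc), mul_zero]

lemma extendMatrix_signedPerm (Y : Finset Λ) (σ : Equiv.Perm (SubConfig q Y))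
    (ε : SubConfig q Y → ℤˣ) :
    extendMatrix Y (signedPerm σ ε) =
      signedPerm (liftPerm Y σ) fun c : Config q => ε fun i : Y => c i := by
  ext c c'
  simp only [extendMatrix, signedPerm, Matrix.of_apply]
  have : liftPerm Y σ c = c' ↔ (∀ i, i ∉ Y → c i = c' i) ∧
      σ (fun i : Y => c i) = fun i : Y => c' i := by
    constructor
    · rintro rfl
      exact ⟨fun i hi => (liftPerm_of_notMem σ c hi).symm, (liftPerm_restrict Y σ c).symm⟩
    · rintro ⟨h1, h2⟩
      exact config_ext (Y := Y) ((liftPerm_restrict Y σ c).trans h2)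
        fun i hi => (liftPerm_of_notMem σ c hi).trans (h1 i hi)
  simp only [this]
  split_ifs <;> tauto

/-- The signed permutation operator acting on the sites in `Y`. -/
def signedPermOp (Y : Finset Λ) (σ : Equiv.Perm (SubConfig q Y)) (ε : SubConfig q Y → ℤˣ) : Op q :=
  Matrix.toEuclideanCLM (n := Config q) (𝕜 := ℂ) (extendMatrix Y (signedPerm σ ε))

lemma signedPermOp_mem_unitary (Y : Finset Λ) (σ : Equiv.Perm (SubConfig q Y))
    (ε : SubConfig q Y → ℤˣ) : signedPermOp Y σ ε ∈ unitary (Op q) := by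
  rw [signedPermOp, extendMatrix_signedPerm]
  exact Unitary.map_mem (Matrix.toEuclideanCLM (n := Config q) (𝕜 := ℂ))
    (signedPerm_mem_unitary _ _)

/-- The group of signed permutations of the configurations of `Y`, as an index type. -/
abbrev SignedPermIndex (q : Λ → ℕ) (Y : Finset Λ) : Type :=
  Equiv.Perm (SubConfig q Y) × (SubConfig q Y → ℤˣ)

instance (Y : Finset Λ) : Fintype (SignedPermIndex q Y) := instFintypeProd _ _

/-- The average of `U T U†` over the signed permutations `U` of the configurations of `Y`. -/
def twirl (Y : Finset Λ) (T : Op q) : Op q :=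
  (Fintype.card (SignedPermIndex q Y) : ℂ)⁻¹ • ∑ p : SignedPermIndex q Y,
    signedPermOp Y p.1 p.2 * T * star (signedPermOp Y p.1 p.2)

/-- Flipping the sign at `k` permutes the sign vectors and negates each summand. In the twirl this
kills the matrix entries that are off-diagonal on `Y`. -/
lemma sum_units_mul_eq_zero {ι : Type*} [Fintype ι] [DecidableEq ι] {k k' : ι} (h : k ≠ k') :
    ∑ ε : ι → ℤˣ, ((ε k : ℤ) : ℂ) * ((ε k' : ℤ) : ℂ) = 0 := by
  have h1 := Equiv.sum_comp (Equiv.mulLeft (Pi.mulSingle k (-1) : ι → ℤˣ))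
    fun ε : ι → ℤˣ => ((ε k : ℤ) : ℂ) * ((ε k' : ℤ) : ℂ)
  simp only [Equiv.coe_mulLeft, Pi.mul_apply, Pi.mulSingle_eq_same,
    Pi.mulSingle_eq_of_ne h.symm, one_mul] at h1
  simp only [neg_mul, one_mul, Units.val_neg, Int.cast_neg, Finset.sum_neg_distrib] at h1
  exact self_eq_neg.1 h1.symm

lemma sum_signedPerm_eq_zero {Y : Finset Λ} (M : Matrix (Config q) (Config q) ℂ)
    {c c' : Config q} (h : (fun i : Y => c i) ≠ fun i : Y => c' i) :
    ∑ p : SignedPermIndex q Y, ((p.2 (fun i : Y => c i) : ℤ) : ℂ) *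
      ((p.2 (fun i : Y => c' i) : ℤ) : ℂ) * M (liftPerm Y p.1 c) (liftPerm Y p.1 c') = 0 := by
  rw [Fintype.sum_prod_type]
  refine Finset.sum_eq_zero fun σ _ => ?_
  simp only
  rw [← Finset.sum_mul, sum_units_mul_eq_zero h, zero_mul]

/-- On entries diagonal on `Y` the signs square to `1`, and the average over permutations forgets
which configuration of `Y` is present. With the vanishing of the off-diagonal entries, the average
acts as the identity on `Y`, so a finite group replaces the Haar average over unitaries. -/
lemma sum_signedPerm_eq {Y : Finset Λ} (M : Matrix (Config q) (Config q) ℂ)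
    {c c' g g' : Config q} (h : (fun i : Y => c i) = fun i : Y => c' i)
    (hg : (fun i : Y => g i) = fun i : Y => g' i) (hc : ∀ i, i ∉ Y → g i = c i)
    (hc' : ∀ i, i ∉ Y → g' i = c' i) :
    ∑ p : SignedPermIndex q Y, ((p.2 (fun i : Y => c i) : ℤ) : ℂ) *
      ((p.2 (fun i : Y => c' i) : ℤ) : ℂ) * M (liftPerm Y p.1 c) (liftPerm Y p.1 c') =
    ∑ p : SignedPermIndex q Y, ((p.2 (fun i : Y => g i) : ℤ) : ℂ) *
      ((p.2 (fun i : Y => g' i) : ℤ) : ℂ) * M (liftPerm Y p.1 g) (liftPerm Y p.1 g') := by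
  have hsq : ∀ u : ℤˣ, ((u : ℤ) : ℂ) * ((u : ℤ) : ℂ) = 1 := fun u => by
    exact_mod_cast Int.units_coe_mul_self u
  simp only [← h, ← hg, hsq, one_mul]
  rw [Fintype.sum_prod_type, Fintype.sum_prod_type]
  simp only [Finset.sum_const, ← Finset.smul_sum]
  congr 1
  -- Translating the sum over permutations by this swap carries the configuration of `c` on `Y` to
  -- that of `g`.
  set τ := Equiv.swap (fun i : Y => c i) fun i : Y => g i with hτ
  have e1 : liftPerm Y τ c = g := by
    refine config_ext (Y := Y) ?_ fun i hi => ?_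
    · rw [liftPerm_restrict, hτ, Equiv.swap_apply_left]
    · rw [liftPerm_of_notMem _ _ hi, hc i hi]
  have e2 : liftPerm Y τ c' = g' := by
    refine config_ext (Y := Y) ?_ fun i hi => ?_
    · rw [liftPerm_restrict, hτ, ← h, Equiv.swap_apply_left, hg]
    · rw [liftPerm_of_notMem _ _ hi, hc' i hi]
  rw [← Equiv.sum_comp (Equiv.mulRight τ)]
  simp only [Equiv.coe_mulRight, liftPerm_mul, e1, e2]

lemma toEuclideanCLM_twirl (Y : Finset Λ) (M : Matrix (Config q) (Config q) ℂ) :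
    twirl Y (Matrix.toEuclideanCLM (n := Config q) (𝕜 := ℂ) M) =
      Matrix.toEuclideanCLM (n := Config q) (𝕜 := ℂ) (Matrix.of fun c c' =>
        (Fintype.card (SignedPermIndex q Y) : ℂ)⁻¹ * ∑ p : SignedPermIndex q Y,
          ((p.2 (fun i : Y => c i) : ℤ) : ℂ) * ((p.2 (fun i : Y => c' i) : ℤ) : ℂ) *
            M (liftPerm Y p.1 c) (liftPerm Y p.1 c')) := by
  simp only [twirl, signedPermOp]
  simp only [← map_star, ← map_mul, ← map_sum, ← map_smul]
  congr 1
  ext c c'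
  simp only [extendMatrix_signedPerm, Matrix.smul_apply, Matrix.sum_apply, Matrix.of_apply,
    Matrix.star_eq_conjTranspose, signedPerm_mul_conjTranspose, smul_eq_mul]

lemma supportedIn_twirl (hq : ∀ i, 1 ≤ q i) (X : Finset Λ) (T : Op q) :
    SupportedIn X (twirl Xᶜ T) := by
  obtain ⟨M, rfl⟩ : ∃ M, Matrix.toEuclideanCLM (n := Config q) (𝕜 := ℂ) M = T :=
    (Matrix.toEuclideanCLM (n := Config q) (𝕜 := ℂ)).surjective T
  rw [toEuclideanCLM_twirl]
  -- A reference configuration outside `X`; it exists because every site has dimension at least `1`,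
  -- and by the lemma above its choice does not matter.
  let glue : SubConfig q X → Config q := fun x i =>
    if h : i ∈ X then x ⟨i, h⟩ else ⟨0, hq i⟩
  refine ⟨fun x x' => (Fintype.card (SignedPermIndex q Xᶜ) : ℂ)⁻¹ *
    ∑ p : SignedPermIndex q Xᶜ, ((p.2 (fun i : (Xᶜ : Finset Λ) => glue x i) : ℤ) : ℂ) *
      ((p.2 (fun i : (Xᶜ : Finset Λ) => glue x' i) : ℤ) : ℂ) *
        M (liftPerm Xᶜ p.1 (glue x)) (liftPerm Xᶜ p.1 (glue x')), ?_⟩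
  congr 1
  ext c c'
  simp only [extendMatrix, Matrix.of_apply]
  split_ifs with h
  · congr 1
    refine sum_signedPerm_eq M ?_ ?_ ?_ ?_
    · funext i
      exact h i (Finset.mem_compl.1 i.2)
    · funext i
      simp [glue, Finset.mem_compl.1 i.2]
    · intro i hi
      simp [glue, (by simpa using hi : i ∈ X)]
    · intro i hi
      simp [glue, (by simpa using hi : i ∈ X)]
  · rw [sum_signedPerm_eq_zero, mul_zero]
    intro h'
    exact h fun i hi => congrFun h' ⟨i, Finset.mem_compl.2 hi⟩

lemma norm_twirl_le (Y : Finset Λ) (T : Op q) : ‖twirl Y T‖ ≤ ‖T‖ := by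
  have hcard : (0 : ℝ) < Fintype.card (SignedPermIndex q Y) := by
    exact_mod_cast Fintype.card_pos
  rw [twirl, norm_smul, norm_inv, Complex.norm_natCast, inv_mul_le_iff₀ hcard]
  refine (norm_sum_le _ _).trans ?_
  refine (Finset.sum_le_card_nsmul _ _ ‖T‖ fun p _ => ?_).trans_eq (by simp)
  rw [CStarRing.norm_mul_mem_unitary _ (Unitary.star_mem (signedPermOp_mem_unitary Y p.1 p.2)),
    CStarRing.norm_mem_unitary_mul _ (signedPermOp_mem_unitary Y p.1 p.2)]

/-- For each unitary `U` of the average, `(T - U T U†) U = [T, U]`, so every term is within `b` of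
zero. -/
lemma norm_sub_twirl_le (Y : Finset Λ) (T : Op q) {b : ℝ}
    (h : ∀ B : Op q, SupportedIn Y B → ‖B‖ ≤ 1 → ‖⁅T, B⁆‖ ≤ b) : ‖T - twirl Y T‖ ≤ b := by
  have hcard : (0 : ℝ) < Fintype.card (SignedPermIndex q Y) := by
    exact_mod_cast Fintype.card_pos
  have hT : T = (Fintype.card (SignedPermIndex q Y) : ℂ)⁻¹ • ∑ _p : SignedPermIndex q Y, T := by
    rw [Finset.sum_const, Finset.card_univ, ← Nat.cast_smul_eq_nsmul ℂ, smul_smul,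
      inv_mul_cancel₀ (by exact_mod_cast hcard.ne'), one_smul]
  have e : T - twirl Y T = (Fintype.card (SignedPermIndex q Y) : ℂ)⁻¹ •
      ∑ p : SignedPermIndex q Y,
        (T - signedPermOp Y p.1 p.2 * T * star (signedPermOp Y p.1 p.2)) := by
    rw [Finset.sum_sub_distrib, smul_sub, ← hT]; rfl
  rw [e, norm_smul, norm_inv, Complex.norm_natCast, inv_mul_le_iff₀ hcard]
  refine (norm_sum_le _ _).trans ?_
  refine (Finset.sum_le_card_nsmul _ _ b fun p _ => ?_).trans_eq (by simp)
  set U := signedPermOp Y p.1 p.2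
  have hU : U ∈ unitary (Op q) := signedPermOp_mem_unitary Y p.1 p.2
  rw [← CStarRing.norm_mul_mem_unitary _ hU, sub_mul, mul_assoc _ (star U) U,
    Unitary.star_mul_self_of_mem hU, mul_one, ← Ring.lie_def]
  refine h U ⟨_, rfl⟩ ?_
  have := CStarRing.norm_mem_unitary_mul (1 : Op q) hU
  rw [mul_one] at this
  rw [this]
  exact ContinuousLinearMap.norm_id_le

lemma supportedIn_univ (T : Op q) : SupportedIn Finset.univ T := by
  obtain ⟨M, rfl⟩ : ∃ M, Matrix.toEuclideanCLM (n := Config q) (𝕜 := ℂ) M = T :=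
    (Matrix.toEuclideanCLM (n := Config q) (𝕜 := ℂ)).surjective T
  refine ⟨fun x x' => M (fun i => x ⟨i, Finset.mem_univ i⟩) fun i => x' ⟨i, Finset.mem_univ i⟩, ?_⟩
  congr 1
  ext c c'
  simp [extendMatrix]

lemma extendMatrix_add (S : Finset Λ) (A B : Matrix (SubConfig q S) (SubConfig q S) ℂ) :
    extendMatrix S (A + B) = extendMatrix S A + extendMatrix S B := by
  ext c c'
  simp only [extendMatrix, Matrix.add_apply]
  split_ifs <;> simp

lemma extendMatrix_smul (S : Finset Λ) (z : ℂ) (A : Matrix (SubConfig q S) (SubConfig q S) ℂ) :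
    extendMatrix S (z • A) = z • extendMatrix S A := by
  ext c c'
  simp only [extendMatrix, Matrix.smul_apply]
  split_ifs <;> simp

lemma SupportedIn.add {S : Finset Λ} {A B : Op q} (hA : SupportedIn S A) (hB : SupportedIn S B) :
    SupportedIn S (A + B) := by
  obtain ⟨a, rfl⟩ := hA
  obtain ⟨b, rfl⟩ := hB
  exact ⟨a + b, by rw [extendMatrix_add, map_add]⟩

lemma SupportedIn.smul {S : Finset Λ} {A : Op q} (hA : SupportedIn S A) (z : ℂ) :
    SupportedIn S (z • A) := by
  obtain ⟨a, rfl⟩ := hA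
  exact ⟨z • a, by rw [extendMatrix_smul, map_smul]⟩

lemma supportedIn_zero (S : Finset Λ) : SupportedIn S (0 : Op q) := by
  refine ⟨0, ?_⟩
  have : extendMatrix S (0 : Matrix (SubConfig q S) (SubConfig q S) ℂ) = 0 := by
    ext c c'
    simp [extendMatrix]
  rw [this, map_zero]

lemma SupportedIn.sum {ι : Type*} {S : Finset Λ} {s : Finset ι} {f : ι → Op q}
    (h : ∀ i ∈ s, SupportedIn S (f i)) : SupportedIn S (∑ i ∈ s, f i) :=
  Finset.sum_induction _ _ (fun _ _ => SupportedIn.add) (supportedIn_zero S) h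

lemma SupportedIn.mono {S S' : Finset Λ} (hS : S ⊆ S') {A : Op q} (hA : SupportedIn S A) :
    SupportedIn S' A := by
  obtain ⟨a, rfl⟩ := hA
  classical
  refine ⟨Matrix.of fun x x' => if ∀ i : S', i.1 ∉ S → x i = x' i then
    a (fun i => x ⟨i, hS i.2⟩) (fun i => x' ⟨i, hS i.2⟩) else 0, ?_⟩
  congr 1
  ext c c'
  simp only [extendMatrix, Matrix.of_apply]
  by_cases h : ∀ i, i ∉ S → c i = c' i
  · have h3 : ∀ i : S', i.1 ∉ S → c i = c' i := fun i hi => h i hi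
    rw [if_pos h, if_pos fun i hi => h i fun hi' => hi (hS hi'), if_pos h3]
  · rw [if_neg h]
    by_cases h1 : ∀ i, i ∉ S' → c i = c' i
    · rw [if_pos h1, if_neg]
      intro h2
      refine h fun i hi => ?_
      by_cases hi' : i ∈ S'
      · exact h2 ⟨i, hi'⟩ hi
      · exact h1 i hi'
    · rw [if_neg h1]

/-- An operator that almost commutes with everything outside `X` is close to an operator supported
inside `X`. -/
theorem exists_supportedIn_near (hq : ∀ i, 1 ≤ q i) (X : Finset Λ) (T : Op q) {b : ℝ}
    (h : ∀ B : Op q, SupportedIn Xᶜ B → ‖B‖ ≤ 1 → ‖⁅T, B⁆‖ ≤ b) :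
    ∃ T' : Op q, SupportedIn X T' ∧ ‖T'‖ ≤ ‖T‖ ∧ ‖T - T'‖ ≤ b :=
  ⟨twirl Xᶜ T, supportedIn_twirl hq X T, norm_twirl_le _ T, norm_sub_twirl_le _ T h⟩

end Localization

end Prethermal
end

/-! ### Geometry of simplices and their enlargements -/

noncomputable section
namespace Prethermal

section Geometry

variable {d : ℕ}

lemma sub_le_latticeDist (x y : SimplicialLattice d) (p : Fin (d + 1)) :
    x.1 p - y.1 p ≤ latticeDist x y := by
  unfold latticeDist
  have h1 : (x.1 p - y.1 p).toNat ≤ ∑ p, (x.1 p - y.1 p).toNat :=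
    Finset.single_le_sum (f := fun p => (x.1 p - y.1 p).toNat) (fun _ _ => Nat.zero_le _)
      (Finset.mem_univ p)
  have h2 := Int.self_le_toNat (x.1 p - y.1 p)
  exact h2.trans (by exact_mod_cast h1)

/-- Positive part minus negative part is the difference itself, and coordinate differences sum to
zero. -/
lemma latticeDist_comm (x y : SimplicialLattice d) : latticeDist x y = latticeDist y x := by
  have h : (latticeDist x y : ℤ) - latticeDist y x = 0 := by
    unfold latticeDist
    push_cast
    rw [← Finset.sum_sub_distrib]
    have : ∀ p, ((x.1 p - y.1 p) ⊔ 0) - ((y.1 p - x.1 p) ⊔ 0) = x.1 p - y.1 p := by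
      intro p; omega
    simp only [Int.ofNat_toNat, this]
    rw [Finset.sum_sub_distrib, x.2, y.2, sub_zero]
  omega

lemma abs_sub_le_latticeDist (x y : SimplicialLattice d) (p : Fin (d + 1)) :
    |x.1 p - y.1 p| ≤ latticeDist x y := by
  have h1 := sub_le_latticeDist x y p
  have h2 := sub_le_latticeDist y x p
  rw [latticeDist_comm] at h2
  rw [abs_le]
  omega

lemma latticeDist_le_of_corner {a : Fin (d + 1) → ℤ} {x y : SimplicialLattice d}
    (hx : ∀ p, a p ≤ x.1 p) (hy : ∀ p, a p ≤ y.1 p) : (latticeDist x y : ℤ) ≤ -∑ p, a p := by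
  have : (latticeDist x y : ℤ) ≤ ∑ p, (x.1 p - a p) := by
    unfold latticeDist
    push_cast
    refine Finset.sum_le_sum fun p _ => ?_
    have := hx p
    have := hy p
    simp only [Int.ofNat_toNat]
    omega
  rw [Finset.sum_sub_distrib, x.2] at this
  omega

variable {Λ : Finset (SimplicialLattice d)}

/-- `a` is the corner of the simplex `S`. -/
def IsCorner (S : Finset Λ) (a : Fin (d + 1) → ℤ) : Prop :=
  ∑ p, a p ≤ 0 ∧
    ∀ x : SimplicialLattice d, x ∈ S.map (Function.Embedding.subtype _) ↔ ∀ p, a p ≤ x.1 p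

lemma mem_simplices_iff {S : Finset Λ} : S ∈ simplices Λ ↔ ∃ a, IsCorner S a := by
  simp only [simplices, Finset.mem_filter, Finset.mem_univ, true_and]
  rfl

lemma IsCorner.mem_iff {S : Finset Λ} {a : Fin (d + 1) → ℤ} (h : IsCorner S a) (x : Λ) :
    x ∈ S ↔ ∀ p, a p ≤ x.1.1 p := by
  rw [← h.2]
  simp

lemma IsCorner.exists_mem {S : Finset Λ} {a : Fin (d + 1) → ℤ} (h : IsCorner S a)
    (x : SimplicialLattice d) (hx : ∀ p, a p ≤ x.1 p) : ∃ y ∈ S, y.1 = x := by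
  have := (h.2 x).2 hx
  simpa using this

/-- The `j`-th vertex of the simplex with corner `a`. -/
def simplexVertex (a : Fin (d + 1) → ℤ) (j : Fin (d + 1)) : SimplicialLattice d :=
  ⟨fun p => a p + if p = j then -∑ p, a p else 0, by simp [Finset.sum_add_distrib]⟩

lemma IsCorner.exists_vertex {S : Finset Λ} {a : Fin (d + 1) → ℤ} (h : IsCorner S a)
    (j : Fin (d + 1)) : ∃ y ∈ S, y.1 = simplexVertex a j := by
  refine h.exists_mem _ fun p => ?_
  have := h.1
  simp only [simplexVertex]
  split_ifs <;> omega

lemma exists_fin_ne (hd : 1 ≤ d) (p : Fin (d + 1)) : ∃ j, j ≠ p := by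
  have : Nontrivial (Fin (d + 1)) := Fin.nontrivial_iff_two_le.2 (by omega)
  exact exists_ne p

lemma IsCorner.exists_eq {S : Finset Λ} {a : Fin (d + 1) → ℤ} (hd : 1 ≤ d) (h : IsCorner S a)
    (p : Fin (d + 1)) : ∃ y ∈ S, y.1.1 p = a p := by
  obtain ⟨j, hj⟩ := exists_fin_ne hd p
  obtain ⟨y, hy, hyv⟩ := h.exists_vertex j
  exact ⟨y, hy, by rw [hyv]; simp [simplexVertex, hj.symm]⟩

lemma latticeDist_le_diam {S : Finset Λ} {x y : Λ} (hx : x ∈ S) (hy : y ∈ S) :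
    latticeDist x.1 y.1 ≤ diam S :=
  (Finset.le_sup (f := fun j : Λ => latticeDist x.1 j.1) hy).trans
    (Finset.le_sup (f := fun i : Λ => S.sup fun j => latticeDist i.1 j.1) hx)

lemma diam_le {S : Finset Λ} {n : ℕ} (h : ∀ x ∈ S, ∀ y ∈ S, latticeDist x.1 y.1 ≤ n) :
    diam S ≤ n :=
  Finset.sup_le fun x hx => Finset.sup_le fun y hy => h x hx y hy

/-- The side length bounds every distance, and two distinct vertices attain it; `d ≥ 1` provides a
second vertex. -/
lemma IsCorner.diam_eq {S : Finset Λ} {a : Fin (d + 1) → ℤ} (hd : 1 ≤ d) (h : IsCorner S a) :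
    (diam S : ℤ) = -∑ p, a p := by
  have hs := h.1
  apply le_antisymm
  · have : diam S ≤ (-∑ p, a p).toNat := diam_le fun x hx y hy => by
      have := latticeDist_le_of_corner ((h.mem_iff x).1 hx) ((h.mem_iff y).1 hy)
      omega
    omega
  · obtain ⟨j, hj⟩ := exists_fin_ne hd 0
    obtain ⟨y, hy, hyv⟩ := h.exists_vertex j
    obtain ⟨z, hz, hzv⟩ := h.exists_vertex 0
    have h1 := latticeDist_le_diam hy hz
    have h2 := sub_le_latticeDist y.1 z.1 j
    rw [hyv, hzv] at h2
    have e1 : (simplexVertex a j).1 j = a j + -∑ p, a p := by simp [simplexVertex]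
    have e2 : (simplexVertex a 0).1 j = a j := by simp [simplexVertex, hj]
    rw [e1, e2] at h2
    rw [hyv, hzv] at h1
    omega

/-- The part of `Λ` obtained from the simplex `S` by moving each of its faces outwards by `r`. -/
def enlarge (S : Finset Λ) (r : ℕ) : Finset Λ :=
  open Classical in
  Finset.univ.filter fun x => ∀ p, ∃ y ∈ S, y.1.1 p - r ≤ x.1.1 p

lemma IsCorner.mem_enlarge_iff {S : Finset Λ} {a : Fin (d + 1) → ℤ} (hd : 1 ≤ d)
    (h : IsCorner S a) (r : ℕ) (x : Λ) : x ∈ enlarge S r ↔ ∀ p, a p - r ≤ x.1.1 p := by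
  simp only [enlarge, Finset.mem_filter, Finset.mem_univ, true_and]
  refine forall_congr' fun p => ⟨?_, fun hx => ?_⟩
  · rintro ⟨y, hy, hyx⟩
    have := (h.mem_iff y).1 hy p
    omega
  · obtain ⟨y, hy, hya⟩ := h.exists_eq hd p
    exact ⟨y, hy, by omega⟩

lemma subset_enlarge (S : Finset Λ) (r : ℕ) : S ⊆ enlarge S r := fun x hx => by
  simp only [enlarge, Finset.mem_filter, Finset.mem_univ, true_and]
  exact fun p => ⟨x, hx, by omega⟩

lemma enlarge_zero {S : Finset Λ} (hd : 1 ≤ d) (hS : S ∈ simplices Λ) : enlarge S 0 = S := by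
  obtain ⟨a, ha⟩ := mem_simplices_iff.1 hS
  ext x
  rw [ha.mem_enlarge_iff hd, ha.mem_iff]
  simp

lemma enlarge_mono (S : Finset Λ) {r r' : ℕ} (h : r ≤ r') : enlarge S r ⊆ enlarge S r' := by
  intro x hx
  simp only [enlarge, Finset.mem_filter, Finset.mem_univ, true_and] at hx ⊢
  intro p
  obtain ⟨y, hy, hyx⟩ := hx p
  exact ⟨y, hy, by omega⟩

lemma le_latticeDist_of_notMem_enlarge {S : Finset Λ} {r : ℕ} {x y : Λ} (hx : x ∈ S)
    (hy : y ∉ enlarge S r) : r ≤ latticeDist x.1 y.1 := by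
  simp only [enlarge, Finset.mem_filter, Finset.mem_univ, true_and, not_forall, not_exists,
    not_and] at hy
  obtain ⟨p, hp⟩ := hy
  have h1 := hp x hx
  have h2 := sub_le_latticeDist x.1 y.1 p
  omega

lemma nonempty_of_mem_simplices {S : Finset Λ} (hS : S ∈ simplices Λ) : S.Nonempty := by
  obtain ⟨a, ha⟩ := mem_simplices_iff.1 hS
  obtain ⟨y, hy, -⟩ := ha.exists_vertex 0
  exact ⟨y, hy⟩

lemma univ_mem_simplices (hΛ : IsSimplex Λ) : (Finset.univ : Finset Λ) ∈ simplices Λ := by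
  obtain ⟨b, hb, hΛb⟩ := hΛ
  exact mem_simplices_iff.2 ⟨b, hb, fun x => by simp [hΛb]⟩

/-- Here the shape of `Λ` enters: two simplices of the same orientation meet in the one whose corner
is the coordinatewise maximum. It is nonempty since the corner of `Λ` lies below that of `S`. -/
lemma enlarge_mem_simplices (hd : 1 ≤ d) (hΛ : IsSimplex Λ) {S : Finset Λ} (hS : S ∈ simplices Λ)
    (r : ℕ) : enlarge S r ∈ simplices Λ := by
  obtain ⟨a, ha⟩ := mem_simplices_iff.1 hS
  obtain ⟨b, hb, hΛb⟩ := hΛ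
  have hab : ∀ p, b p ≤ a p := fun p => by
    obtain ⟨y, -, hy⟩ := ha.exists_eq hd p
    rw [← hy]
    exact (hΛb y.1).1 y.2 p
  refine mem_simplices_iff.2 ⟨fun p => max (a p - r) (b p), ?_, fun x => ?_⟩
  · refine (Finset.sum_le_sum fun p _ => ?_).trans ha.1
    have := hab p
    omega
  · simp only [Finset.mem_map, Function.Embedding.subtype_apply]
    constructor
    · rintro ⟨y, hy, rfl⟩ p
      exact max_le ((ha.mem_enlarge_iff hd r y).1 hy p) ((hΛb y.1).1 y.2 p)
    · intro hx
      have hxΛ : x ∈ Λ := (hΛb x).2 fun p => (le_max_right _ _).trans (hx p)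
      exact ⟨⟨x, hxΛ⟩, (ha.mem_enlarge_iff hd r _).2 fun p => (le_max_left _ _).trans (hx p), rfl⟩

lemma diam_enlarge_le (hd : 1 ≤ d) {S : Finset Λ} (hS : S ∈ simplices Λ) (r : ℕ) :
    diam (enlarge S r) ≤ diam S + (d + 1) * r := by
  obtain ⟨a, ha⟩ := mem_simplices_iff.1 hS
  refine diam_le fun x hx y hy => ?_
  have h1 := latticeDist_le_of_corner ((ha.mem_enlarge_iff hd r x).1 hx)
    ((ha.mem_enlarge_iff hd r y).1 hy)
  rw [Finset.sum_sub_distrib] at h1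
  have h2 := ha.diam_eq hd
  simp only [Finset.sum_const, Finset.card_univ, Fintype.card_fin, nsmul_eq_mul] at h1
  zify
  push_cast at h1
  linarith

lemma exists_enlarge_eq_univ {S : Finset Λ} (hS : S.Nonempty) {r : ℕ}
    (hr : diam (Finset.univ : Finset Λ) ≤ r) : enlarge S r = Finset.univ := by
  obtain ⟨y, hy⟩ := hS
  ext x
  simp only [enlarge, Finset.mem_filter, Finset.mem_univ, true_and, iff_true]
  intro p
  refine ⟨y, hy, ?_⟩
  have h1 := sub_le_latticeDist y.1 x.1 p
  have h2 := latticeDist_le_diam (Finset.mem_univ y) (Finset.mem_univ x)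
  omega

/-- The sites of `Λ` all of whose coordinates differ from those of `i` by at most `R`. -/
def box (i : Λ) (R : ℕ) : Finset Λ := Finset.univ.filter fun j => ∀ p, |j.1.1 p - i.1.1 p| ≤ R

lemma mem_box {i j : Λ} {R : ℕ} : j ∈ box i R ↔ ∀ p, |j.1.1 p - i.1.1 p| ≤ R := by
  simp [box]

lemma card_box_le (i : Λ) (R : ℕ) : (box i R).card ≤ (2 * R + 1) ^ (d + 1) := by
  have hinj : Function.Injective fun j : Λ => j.1.1 := fun j j' h => Subtype.ext (Subtype.ext h)
  calc (box i R).card ≤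
      (Fintype.piFinset fun p => Finset.Icc (i.1.1 p - R) (i.1.1 p + R)).card := by
        refine Finset.card_le_card_of_injOn (fun j => j.1.1) (fun j hj => ?_) hinj.injOn
        rw [Finset.mem_coe, Fintype.mem_piFinset]
        intro p
        have := abs_le.1 (mem_box.1 hj p)
        rw [Finset.mem_Icc]
        constructor <;> linarith
    _ = (2 * R + 1) ^ (d + 1) := by
        rw [Fintype.card_piFinset]
        simp only [Int.card_Icc]
        rw [Finset.prod_congr rfl fun p _ => show (i.1.1 p + R + 1 - (i.1.1 p - R)).toNat = 2 * R + 1 by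
          omega]
        simp

/-- The point is `i + r (1, …, 1) - (d + 1) r e_p`. Adding `r` repairs all faces violated by at most
`r`; the compensation in coordinate `p` needs slack `d r` there, which some `p` has by pigeonhole
when the side length is at least `d (d + 1) r`. There are only `d + 1` such points, whatever `S` is.
-/
lemma exists_mem_of_le_diam (hd : 1 ≤ d) {S : Finset Λ} (hS : S ∈ simplices Λ) {r : ℕ} {i : Λ}
    (hi : i ∈ enlarge S r) (hr : d * (d + 1) * r ≤ diam S) :
    ∃ j ∈ S, ∃ p, ∀ p', j.1.1 p' = i.1.1 p' + r - if p' = p then (d + 1) * (r : ℤ) else 0 := by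
  obtain ⟨a, ha⟩ := mem_simplices_iff.1 hS
  have hia := (ha.mem_enlarge_iff hd r i).1 hi
  have hdiam := ha.diam_eq hd
  obtain ⟨p, hp⟩ : ∃ p, a p ≤ i.1.1 p - d * r := by
    by_contra hcon
    push Not at hcon
    have h1 := Finset.sum_lt_sum_of_nonempty (Finset.univ_nonempty (α := Fin (d + 1)))
      fun p _ => hcon p
    rw [Finset.sum_sub_distrib, i.1.2] at h1
    simp only [Finset.sum_const, Finset.card_univ, Fintype.card_fin, nsmul_eq_mul] at h1
    zify at hr
    push_cast at h1
    linarith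
  let x : SimplicialLattice d :=
    ⟨fun p' => i.1.1 p' + r - if p' = p then (d + 1) * (r : ℤ) else 0, by
      rw [Finset.sum_sub_distrib, Finset.sum_add_distrib, i.1.2]
      simp⟩
  obtain ⟨y, hy, hyx⟩ := ha.exists_mem x fun p' => by
    simp only [x]
    split_ifs with h
    · subst h; linarith
    · have := hia p'
      omega
  exact ⟨y, hy, p, fun p' => by rw [hyx]⟩

/-- Large simplices contain the shifted point of the preceding lemma. For a small one, the whole
enlargement has diameter at most `d (d + 1) r + (d + 1) r = (d + 1)² r`. -/
lemma exists_mem_box (hd : 1 ≤ d) {S : Finset Λ} (hS : S ∈ simplices Λ) {r : ℕ} {i : Λ}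
    (hi : i ∈ enlarge S r) : ∃ j ∈ S, j ∈ box i ((d + 1) ^ 2 * r) := by
  by_cases hr : d * (d + 1) * r ≤ diam S
  · obtain ⟨j, hj, p, hp⟩ := exists_mem_of_le_diam hd hS hi hr
    refine ⟨j, hj, mem_box.2 fun p' => ?_⟩
    rw [hp, abs_le]
    push_cast
    have hr0 : (0 : ℤ) ≤ r := by positivity
    have hd0 : (0 : ℤ) ≤ d := by positivity
    have h3 : (0 : ℤ) ≤ d * r := by positivity
    have h4 : (0 : ℤ) ≤ d * (d * r) := by positivity
    split_ifs <;> constructor <;> nlinarith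
  · obtain ⟨j, hj⟩ := nonempty_of_mem_simplices hS
    refine ⟨j, hj, mem_box.2 fun p => ?_⟩
    have h1 := abs_sub_le_latticeDist j.1 i.1 p
    have h2 := latticeDist_le_diam (subset_enlarge S r hj) hi
    have h3 := diam_enlarge_le hd hS r
    have h4 : diam S + (d + 1) * r ≤ (d + 1) ^ 2 * r := by nlinarith
    have h5 : latticeDist j.1 i.1 ≤ (d + 1) ^ 2 * r := by omega
    refine h1.trans ?_
    exact_mod_cast h5

/-- Enlargements of large simplices are hit by a set of `d + 1` points. -/
lemma exists_hittingSet (hd : 1 ≤ d) (i : Λ) (r : ℕ) : ∃ J : Finset Λ, J.card ≤ d + 1 ∧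
    ∀ S ∈ simplices Λ, d * (d + 1) * r ≤ diam S → i ∈ enlarge S r → ∃ j ∈ J, j ∈ S := by
  classical
  let J : Finset Λ := Finset.univ.biUnion fun p : Fin (d + 1) => Finset.univ.filter fun j : Λ =>
    ∀ p', j.1.1 p' = i.1.1 p' + r - if p' = p then (d + 1) * (r : ℤ) else 0
  refine ⟨J, ?_, fun S hS hr hi => ?_⟩
  · refine Finset.card_biUnion_le.trans ((Finset.sum_le_card_nsmul _ _ 1 fun p _ => ?_).trans_eq
      (by simp))
    refine Finset.card_le_one.2 fun j hj j' hj' => ?_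
    simp only [Finset.mem_filter, Finset.mem_univ, true_and] at hj hj'
    exact Subtype.ext (Subtype.ext (funext fun p' => (hj p').trans (hj' p').symm))
  · obtain ⟨j, hj, p, hp⟩ := exists_mem_of_le_diam hd hS hi hr
    exact ⟨j, by simp only [J, Finset.mem_biUnion, Finset.mem_filter, Finset.mem_univ, true_and];
                 exact ⟨p, hp⟩, hj⟩

lemma boundary_subset (S : Finset Λ) : boundary S ⊆ S := by
  classical
  exact Finset.filter_subset _ _

lemma card_boundary_le {S : Finset Λ} (hS : S.Nonempty) :
    (boundary S).card ≤ (2 * diam S + 1) ^ (d + 1) := by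
  obtain ⟨i, hi⟩ := hS
  refine le_trans (Finset.card_le_card fun j hj => mem_box.2 fun p => ?_) (card_box_le i (diam S))
  have h1 := abs_sub_le_latticeDist j.1 i.1 p
  have h2 := latticeDist_le_diam (boundary_subset S hj) hi
  exact h1.trans (by exact_mod_cast h2)

/-- A boundary site has a neighbour violating some face, so it lies on that face; in dimension one a
face is a single point. -/
lemma card_boundary_le_two {Λ : Finset (SimplicialLattice 1)} {S : Finset Λ}
    (hS : S ∈ simplices Λ) : (boundary S).card ≤ 2 := by
  classical
  obtain ⟨a, ha⟩ := mem_simplices_iff.1 hS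
  have hsub : boundary S ⊆ Finset.univ.biUnion fun p : Fin 2 =>
      Finset.univ.filter fun j : Λ => j.1.1 p = a p := by
    intro j hj
    have hjS := (ha.mem_iff j).1 (boundary_subset S hj)
    simp only [boundary, Finset.mem_filter] at hj
    obtain ⟨-, k, hk, hjk⟩ := hj
    rw [ha.mem_iff] at hk
    push Not at hk
    obtain ⟨p, hp⟩ := hk
    simp only [Finset.mem_biUnion, Finset.mem_filter, Finset.mem_univ, true_and]
    refine ⟨p, ?_⟩
    have h1 := sub_le_latticeDist j.1 k.1 p
    have h2 := hjS p
    omega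
  refine (Finset.card_le_card hsub).trans (Finset.card_biUnion_le.trans
    ((Finset.sum_le_card_nsmul _ _ 1 fun p _ => ?_).trans_eq (by simp)))
  refine Finset.card_le_one.2 fun j hj j' hj' => ?_
  simp only [Finset.mem_filter, Finset.mem_univ, true_and] at hj hj'
  have e1 := j.1.2
  have e2 := j'.1.2
  rw [Fin.sum_univ_two] at e1 e2
  refine Subtype.ext (Subtype.ext (funext fun p' => ?_))
  fin_cases p <;> fin_cases p' <;> simp at * <;> omega

end Geometry

end Prethermal
end

/-! ### Real estimates for stretched exponentials -/

noncomputable section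
namespace Prethermal

section RealEstimates

/-- By concavity the increment is at most `s l^(α-1)` with `s` logarithmic in `l`, which is bounded
as `α < 1`. Thus logarithmic enlargements change `exp(κ (diam S)^α)` only by a constant factor. -/
lemma exists_rpow_add_log_le {α : ℝ} (hα₀ : 0 < α) (hα₁ : α < 1) {b : ℝ} (hb : 0 ≤ b) :
    ∃ C : ℝ, 0 ≤ C ∧ ∀ l : ℕ, ((l : ℝ) + b * Nat.log 2 (l + 1)) ^ α ≤ (l : ℝ) ^ α + C := by
  have hε : 0 < 1 - α := by linarith
  have hlog2 : 0 < Real.log 2 := Real.log_pos one_lt_two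
  refine ⟨b * (2 ^ (1 - α) / (1 - α) / Real.log 2), by positivity, fun l => ?_⟩
  rcases Nat.eq_zero_or_pos l with rfl | hl
  · simp [Real.zero_rpow hα₀.ne']; positivity
  have hl0 : (0 : ℝ) < l := by exact_mod_cast hl
  have hl1 : (1 : ℝ) ≤ l := by exact_mod_cast hl
  set s : ℝ := b * Nat.log 2 (l + 1) with hs
  have hs0 : 0 ≤ s := by positivity
  have h1 : ((l : ℝ) + s) ^ α ≤ (l : ℝ) ^ α + s * (l : ℝ) ^ (α - 1) := by
    have e : (l : ℝ) + s = l * (1 + s / l) := by field_simp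
    rw [e, Real.mul_rpow hl0.le (by positivity)]
    have h2 := rpow_one_add_le_one_add_mul_self
      (by have : 0 ≤ s / l := by positivity
          linarith : -1 ≤ s / l) hα₀.le hα₁.le
    calc (l : ℝ) ^ α * (1 + s / l) ^ α ≤ (l : ℝ) ^ α * (1 + α * (s / l)) := by gcongr
      _ ≤ (l : ℝ) ^ α * (1 + 1 * (s / l)) := by gcongr
      _ = _ := by rw [Real.rpow_sub_one hl0.ne']; ring
  have h3 : (Nat.log 2 (l + 1) : ℝ) * (l : ℝ) ^ (α - 1) ≤
      2 ^ (1 - α) / (1 - α) / Real.log 2 := by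
    have h4 : (Nat.log 2 (l + 1) : ℝ) ≤ Real.log ((l : ℝ) + 1) / Real.log 2 := by
      have := Real.natLog_le_logb (l + 1) 2
      rw [← Real.log_div_log] at this
      exact_mod_cast this
    have h5 : Real.log ((l : ℝ) + 1) ≤ ((l : ℝ) + 1) ^ (1 - α) / (1 - α) :=
      Real.log_le_rpow_div (by positivity) hε
    have h6 : ((l : ℝ) + 1) ^ (1 - α) ≤ 2 ^ (1 - α) * (l : ℝ) ^ (1 - α) := by
      rw [← Real.mul_rpow (by norm_num) hl0.le]
      exact Real.rpow_le_rpow (by positivity) (by linarith) hε.le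
    have h7 : (l : ℝ) ^ (1 - α) * (l : ℝ) ^ (α - 1) = 1 := by
      rw [← Real.rpow_add hl0]; simp
    have h8 : 0 < (l : ℝ) ^ (α - 1) := Real.rpow_pos_of_pos hl0 _
    calc (Nat.log 2 (l + 1) : ℝ) * (l : ℝ) ^ (α - 1)
        ≤ (2 ^ (1 - α) * (l : ℝ) ^ (1 - α) / (1 - α) / Real.log 2) * (l : ℝ) ^ (α - 1) := by
          gcongr
          refine h4.trans ?_
          gcongr
          refine h5.trans ?_
          gcongr
      _ = 2 ^ (1 - α) / (1 - α) / Real.log 2 * ((l : ℝ) ^ (1 - α) * (l : ℝ) ^ (α - 1)) := by ring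
      _ = _ := by rw [h7, mul_one]
  have h9 := mul_le_mul_of_nonneg_left h3 hb
  have h10 : s * (l : ℝ) ^ (α - 1) = b * ((Nat.log 2 (l + 1) : ℝ) * (l : ℝ) ^ (α - 1)) := by
    rw [hs]; ring
  linarith

/-- Choose `n` with `α n ≥ m + 2` and use `exp y ≥ y^n / n!`: the terms with `r ≥ 1` are then
`O(r⁻²)`. -/
lemma summable_pow_mul_exp_neg_rpow {α : ℝ} (hα₀ : 0 < α) (A : ℝ) (hA : 0 ≤ A) (m : ℕ) :
    Summable fun r : ℕ => (A * r + 1) ^ m * Real.exp (-(r : ℝ) ^ α) := by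
  obtain ⟨n, hn⟩ := exists_nat_ge ((m + 2) / α)
  rw [div_le_iff₀ hα₀] at hn
  have hs : Summable fun r : ℕ => ((A + 1) ^ m * n.factorial) * (1 / (r : ℝ) ^ 2) :=
    (Real.summable_one_div_nat_pow.2 one_lt_two).mul_left _
  refine (summable_nat_add_iff 1).1 (Summable.of_nonneg_of_le (fun r => by positivity)
    (fun r => ?_) ((summable_nat_add_iff 1).2 hs))
  set x : ℝ := ((r + 1 : ℕ) : ℝ) with hx
  have hx1 : 1 ≤ x := by rw [hx]; push_cast; linarith [Nat.cast_nonneg (α := ℝ) r]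
  have h1 : (A * x + 1) ^ m ≤ (A + 1) ^ m * x ^ m := by
    rw [← mul_pow]
    gcongr
    linarith
  have h2 : Real.exp (-x ^ α) ≤ n.factorial / (x ^ m * x ^ 2) := by
    have h3 := Real.pow_div_factorial_le_exp (x ^ α) (by positivity) n
    have h4 : x ^ m * x ^ 2 ≤ (x ^ α) ^ n := by
      rw [← Real.rpow_natCast (x ^ α), ← Real.rpow_mul (by linarith), ← pow_add,
        ← Real.rpow_natCast x]
      refine Real.rpow_le_rpow_of_exponent_le hx1 ?_
      push_cast
      linarith
    rw [Real.exp_neg, inv_le_comm₀ (Real.exp_pos _) (by positivity), inv_div]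
    refine le_trans ?_ h3
    gcongr
  calc (A * x + 1) ^ m * Real.exp (-x ^ α)
      ≤ (A + 1) ^ m * x ^ m * (n.factorial / (x ^ m * x ^ 2)) := by gcongr
    _ = (A + 1) ^ m * n.factorial * (1 / x ^ 2) := by field_simp

/-- This is where the logarithm arises. About `log(1/δ) / (α log 2)` terms have `δ 2^(α m) ≤ 1` and
are bounded by `1`; beyond them `exp(-y) ≤ 1/y` gives a geometric series of ratio `2^(-α)`. -/
lemma exists_sum_exp_neg_le_log {α : ℝ} (hα₀ : 0 < α) : ∃ C : ℝ, 0 ≤ C ∧ ∀ δ : ℝ, 0 < δ →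
    ∀ N : ℕ, ∑ m ∈ Finset.range N, Real.exp (-(δ * ((2 : ℝ) ^ m - 1) ^ α)) ≤
      C * max 1 (-Real.log δ) := by
  have hlog2 : 0 < Real.log 2 := Real.log_pos one_lt_two
  set θ : ℝ := 2 ^ (-α) with hθ
  have hθ0 : 0 < θ := by positivity
  have hθ1 : θ < 1 := Real.rpow_lt_one_of_one_lt_of_neg one_lt_two (by linarith)
  refine ⟨1 / (α * Real.log 2) + 2 + (1 - θ)⁻¹, by
    have : 0 < 1 - θ := by linarith
    positivity, fun δ hδ N => ?_⟩
  set L := max 1 (-Real.log δ) with hL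
  have hL1 : 1 ≤ L := le_max_left _ _
  set n := ⌈L / (α * Real.log 2)⌉₊ with hn
  have hn1 : L ≤ α * Real.log 2 * n := by
    have := Nat.le_ceil (L / (α * Real.log 2))
    rw [div_le_iff₀ (by positivity)] at this
    linarith
  have hn2 : (n : ℝ) ≤ L / (α * Real.log 2) + 1 := (Nat.ceil_lt_add_one (by positivity)).le
  have hδn : 1 ≤ δ * (2 : ℝ) ^ (α * n) := by
    rw [← Real.log_nonneg_iff (by positivity), Real.log_mul hδ.ne' (by positivity),
      Real.log_rpow (by norm_num)]
    have : -Real.log δ ≤ L := le_max_right _ _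
    nlinarith
  have hle : ∀ m, Real.exp (-(δ * ((2 : ℝ) ^ m - 1) ^ α)) ≤ 1 := fun m => by
    rw [Real.exp_le_one_iff, neg_nonpos]
    have : (1 : ℝ) ≤ 2 ^ m := one_le_pow₀ (by norm_num)
    exact mul_nonneg hδ.le (Real.rpow_nonneg (by linarith) _)
  have hgeo : ∀ k, Real.exp (-(δ * ((2 : ℝ) ^ (n + 1 + k) - 1) ^ α)) ≤ θ ^ k := fun k => by
    have h1 : (2 : ℝ) ^ (n + k) ≤ 2 ^ (n + 1 + k) - 1 := by
      have : (1 : ℝ) ≤ 2 ^ (n + k) := one_le_pow₀ (by norm_num)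
      rw [show n + 1 + k = n + k + 1 by ring, pow_succ]
      linarith
    have h2 : (2 : ℝ) ^ (α * k) ≤ δ * ((2 : ℝ) ^ (n + 1 + k) - 1) ^ α := by
      calc (2 : ℝ) ^ (α * k) ≤ δ * (2 : ℝ) ^ (α * n) * (2 : ℝ) ^ (α * k) :=
            le_mul_of_one_le_left (by positivity) hδn
        _ = δ * ((2 : ℝ) ^ (n + k)) ^ α := by
            rw [mul_assoc, ← Real.rpow_add (by norm_num), ← Real.rpow_natCast,
              ← Real.rpow_mul (by norm_num)]
            congr 2; push_cast; ring
        _ ≤ _ := by gcongr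
    have h3 : θ ^ k = ((2 : ℝ) ^ (α * k))⁻¹ := by
      rw [hθ, ← Real.rpow_natCast, ← Real.rpow_mul (by norm_num), ← Real.rpow_neg (by norm_num)]
      congr 1; ring
    rw [h3, Real.exp_neg]
    refine inv_anti₀ (by positivity) (h2.trans ?_)
    linarith [Real.add_one_le_exp (δ * ((2 : ℝ) ^ (n + 1 + k) - 1) ^ α)]
  calc ∑ m ∈ Finset.range N, Real.exp (-(δ * ((2 : ℝ) ^ m - 1) ^ α))
      ≤ ∑ m ∈ Finset.range (n + 1 + N), Real.exp (-(δ * ((2 : ℝ) ^ m - 1) ^ α)) :=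
        Finset.sum_le_sum_of_subset_of_nonneg (Finset.range_mono (by omega))
          fun _ _ _ => (Real.exp_pos _).le
    _ ≤ (n + 1) + ∑ k ∈ Finset.range N, θ ^ k := by
        rw [Finset.sum_range_add]
        refine add_le_add ((Finset.sum_le_card_nsmul _ _ 1 fun m _ => hle m).trans_eq (by simp))
          (Finset.sum_le_sum fun k _ => hgeo k)
    _ ≤ (n + 1) + (1 - θ)⁻¹ := by
        rw [← tsum_geometric_of_lt_one hθ0.le hθ1]
        exact add_le_add le_rfl ((summable_geometric_of_lt_one hθ0.le hθ1).sum_le_tsum _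
          fun k _ => by positivity)
    _ ≤ (1 / (α * Real.log 2) + 2 + (1 - θ)⁻¹) * L := by
        have h1 : 0 < (1 - θ)⁻¹ := inv_pos.2 (by linarith)
        have h2 : L / (α * Real.log 2) = 1 / (α * Real.log 2) * L := by ring
        nlinarith

/-- Beyond the crossing point `x₀ = (K/c)^(1/(1-α))` the linear term dominates; below it the left
side is at most its value at `x₀`. -/
lemma exists_mul_rpow_le_mul_add {α : ℝ} (hα₀ : 0 < α) (hα₁ : α < 1) {K c : ℝ} (hK : 0 ≤ K)
    (hc : 0 < c) : ∃ C : ℝ, 0 ≤ C ∧ ∀ x : ℝ, 0 ≤ x → K * x ^ α ≤ c * x + C := by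
  set x₀ := (K / c) ^ (1 / (1 - α)) with hx₀
  have hx₀0 : 0 ≤ x₀ := by positivity
  have hε : 0 < 1 - α := by linarith
  refine ⟨K * x₀ ^ α, by positivity, fun x hx => ?_⟩
  rcases le_or_gt x x₀ with h | h
  · have : K * x ^ α ≤ K * x₀ ^ α := by gcongr
    nlinarith
  · have hx' : 0 < x := hx₀0.trans_lt h
    have h1 : K / c ≤ x ^ (1 - α) := by
      calc K / c = x₀ ^ (1 - α) := by
            rw [hx₀, ← Real.rpow_mul (by positivity), one_div_mul_cancel hε.ne', Real.rpow_one]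
        _ ≤ x ^ (1 - α) := by gcongr
    rw [div_le_iff₀ hc] at h1
    have h2 : x ^ (1 - α) * x ^ α = x := by
      rw [← Real.rpow_add hx']; simp
    have h3 : K * x ^ α ≤ c * x := by
      calc K * x ^ α ≤ x ^ (1 - α) * c * x ^ α := by gcongr
        _ = c * (x ^ (1 - α) * x ^ α) := by ring
        _ = c * x := by rw [h2]
    have h4 : 0 ≤ K * x₀ ^ α := by positivity
    linarith

/-- With `m = log₂(l + 1)` rounded down, `2l + 1 ≤ 4 * 2^m`, and `c a ≥ n` gives `exp(-c r) ≤ 2^(-m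
n)`. This `a` fixes the starting radius that absorbs the boundary factor. -/
lemma exists_pow_mul_exp_neg_log_le (n : ℕ) {c : ℝ} (hc : 0 < c) :
    ∃ a : ℕ, ∀ l r : ℕ, a * Nat.log 2 (l + 1) ≤ r →
      (2 * (l : ℝ) + 1) ^ n * Real.exp (-(c * r)) ≤ 4 ^ n := by
  obtain ⟨a, ha⟩ := exists_nat_ge (n / c)
  rw [div_le_iff₀ hc] at ha
  refine ⟨a, fun l r hr => ?_⟩
  set m := Nat.log 2 (l + 1) with hm
  have h1 : (l : ℝ) + 1 ≤ 2 * 2 ^ m := by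
    have := Nat.lt_pow_succ_log_self one_lt_two (l + 1)
    rw [← hm] at this
    have h := this.le
    rw [pow_succ'] at h
    exact_mod_cast h
  have h2 : Real.exp (-(c * r)) ≤ ((2 : ℝ) ^ m)⁻¹ ^ n := by
    rw [inv_pow, Real.exp_neg]
    refine inv_anti₀ (by positivity) ?_
    rw [← pow_mul]
    calc (2 : ℝ) ^ (m * n) ≤ Real.exp 1 ^ (m * n) := by
          gcongr; linarith [Real.add_one_le_exp 1]
      _ = Real.exp (m * n) := by rw [← Real.exp_nat_mul]; push_cast; ring_nf
      _ ≤ Real.exp (c * r) := by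
          refine Real.exp_le_exp.2 ?_
          have h3 : (a : ℝ) * m ≤ r := by exact_mod_cast hr
          have h4 := mul_le_mul_of_nonneg_left h3 hc.le
          have h5 := mul_le_mul_of_nonneg_left ha (Nat.cast_nonneg (α := ℝ) m)
          linarith
  calc (2 * (l : ℝ) + 1) ^ n * Real.exp (-(c * r))
      ≤ (4 * 2 ^ m) ^ n * ((2 : ℝ) ^ m)⁻¹ ^ n := by
        gcongr
        linarith
    _ = 4 ^ n := by
        rw [← mul_pow, mul_assoc, mul_inv_cancel₀ (by positivity), mul_one]

end RealEstimates

end Prethermal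
end

/-! ### Counting enlarged simplices through a site -/

noncomputable section
namespace Prethermal

section Counting

variable {d : ℕ} {Λ : Finset (SimplicialLattice d)}

/-- Union bound: a sum over simplices hit by `H` is at most the sum over `j ∈ H` of the local sums
at `j`. -/
lemma sum_le_card_mul_of_hits {𝒮 𝒯 : Finset (Finset Λ)} {H : Finset Λ} {h : Finset Λ → ℝ} {N : ℝ}
    (hST : 𝒮 ⊆ 𝒯) (hh : ∀ S, 0 ≤ h S) (hit : ∀ S ∈ 𝒮, ∃ j ∈ H, j ∈ S)
    (hN : ∀ j, ∑ S ∈ 𝒯 with j ∈ S, h S ≤ N) : ∑ S ∈ 𝒮, h S ≤ H.card * N := by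
  calc ∑ S ∈ 𝒮, h S ≤ ∑ S ∈ 𝒮, ∑ j ∈ H, if j ∈ S then h S else 0 := by
        refine Finset.sum_le_sum fun S hS => ?_
        obtain ⟨j, hj, hjS⟩ := hit S hS
        refine le_trans (by rw [if_pos hjS]) (Finset.single_le_sum
          (f := fun j => if j ∈ S then h S else 0) (fun k _ => ?_) hj)
        split_ifs
        exacts [hh S, le_rfl]
    _ = ∑ j ∈ H, ∑ S ∈ 𝒮, if j ∈ S then h S else 0 := Finset.sum_comm
    _ ≤ ∑ j ∈ H, N := by
        refine Finset.sum_le_sum fun j _ => ?_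
        refine le_trans ?_ (hN j)
        rw [← Finset.sum_filter]
        exact Finset.sum_le_sum_of_subset_of_nonneg (Finset.filter_subset_filter _ hST)
          fun S _ _ => hh S
    _ = H.card * N := by simp

lemma sum_enlarge_le (hd : 1 ≤ d) (i : Λ) (r : ℕ) {h : Finset Λ → ℝ} {N : ℝ} (hh : ∀ S, 0 ≤ h S)
    (hN0 : 0 ≤ N) (hN : ∀ j, ∑ S ∈ simplices Λ with j ∈ S, h S ≤ N) :
    ∑ S ∈ simplices Λ with i ∈ enlarge S r, h S ≤
      (2 * ((d : ℝ) + 1) ^ 2 * r + 1) ^ (d + 1) * N := by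
  refine (sum_le_card_mul_of_hits (H := box i ((d + 1) ^ 2 * r)) (Finset.filter_subset _ _) hh
    (fun S hS => ?_) hN).trans ?_
  · rw [Finset.mem_filter] at hS
    obtain ⟨j, hj, hjb⟩ := exists_mem_box hd hS.1 hS.2
    exact ⟨j, hjb, hj⟩
  · gcongr
    refine (Nat.cast_le.2 (card_box_le i ((d + 1) ^ 2 * r))).trans_eq ?_
    push_cast
    ring

lemma exists_mul_lt_two_pow (D : ℕ) : ∃ m₀ : ℕ, ∀ m, m₀ ≤ m → D * m + 1 ≤ 2 ^ m := by
  have hsq : ∀ m : ℕ, 5 ≤ m → m * m < 2 ^ m := by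
    intro m hm
    induction m, hm using Nat.le_induction with
    | base => norm_num
    | succ n hn ih => rw [pow_succ]; nlinarith
  refine ⟨D + 5, fun m hm => ?_⟩
  have h1 := hsq m (by omega)
  have h2 : D * m ≤ m * m := Nat.mul_le_mul_right m (by omega)
  omega

/-- The bound is uniform in the dyadic class `m`. For `m ≥ m₀` the diameter, at least `2^m - 1`,
exceeds `d (d + 1) a m` and `d + 1` points suffice; for the finitely many smaller `m` a box does. -/
lemma exists_hittingSet_log (hd : 1 ≤ d) (a : ℕ) : ∃ C : ℝ, 0 ≤ C ∧
    ∀ (Λ : Finset (SimplicialLattice d)) (i : Λ) (m : ℕ), ∃ J : Finset Λ, (J.card : ℝ) ≤ C ∧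
      ∀ S ∈ simplices Λ, Nat.log 2 (diam S + 1) = m → i ∈ enlarge S (a * m) → ∃ j ∈ J, j ∈ S := by
  obtain ⟨m₀, hm₀⟩ := exists_mul_lt_two_pow (d * (d + 1) * a)
  refine ⟨((d + 1 + (2 * ((d + 1) ^ 2 * (a * m₀)) + 1) ^ (d + 1) : ℕ) : ℝ), by positivity,
    fun Λ i m => ?_⟩
  by_cases hm : m₀ ≤ m
  · obtain ⟨J, hJ, hit⟩ := exists_hittingSet hd i (a * m)
    refine ⟨J, by exact_mod_cast hJ.trans (Nat.le_add_right _ _), fun S hS hSm hi => hit S hS ?_ hi⟩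
    have h1 := hm₀ m hm
    have h2 : 2 ^ m ≤ diam S + 1 := by
      rw [← hSm]; exact Nat.pow_log_le_self 2 (by omega)
    have h3 : d * (d + 1) * (a * m) = d * (d + 1) * a * m := by ring
    omega
  · refine ⟨box i ((d + 1) ^ 2 * (a * m)), ?_, fun S hS hSm hi => ?_⟩
    · have h1 := card_box_le i ((d + 1) ^ 2 * (a * m))
      have h2 : (2 * ((d + 1) ^ 2 * (a * m)) + 1) ^ (d + 1) ≤
          (2 * ((d + 1) ^ 2 * (a * m₀)) + 1) ^ (d + 1) := by
        push Not at hm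
        gcongr
      exact_mod_cast (h1.trans h2).trans (Nat.le_add_left _ _)
    · obtain ⟨j, hj, hjb⟩ := exists_mem_box hd hS hi
      exact ⟨j, hjb, hj⟩

lemma diam_le_diam_univ (S : Finset Λ) : diam S ≤ diam (Finset.univ : Finset Λ) :=
  diam_le fun x _ y _ => latticeDist_le_diam (Finset.mem_univ x) (Finset.mem_univ y)

/-- The radius by which a simplex is enlarged before its evolution is localised. -/
def logRadius (a : ℕ) (S : Finset Λ) : ℕ := a * Nat.log 2 (diam S + 1)

lemma logRadius_le (a : ℕ) (S : Finset Λ) :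
    logRadius a S ≤ logRadius a (Finset.univ : Finset Λ) :=
  Nat.mul_le_mul_left a (Nat.log_mono_right (Nat.succ_le_succ (diam_le_diam_univ S)))

/-- Within a dyadic class the hitting set gives a bounded multiple of `N`, and lowering `κ` to `κ'`
gains `exp(-(κ - κ') (2^m - 1)^α)`. Summing over `m` yields one logarithm. For `d = 1` the radius is
zero and the sum is the original local norm. -/
lemma exists_sum_logRadius_le (hd : 1 ≤ d) {α : ℝ} (hα₀ : 0 < α) (a : ℕ) (ha : d = 1 → a = 0) :
    ∃ C : ℝ, 0 ≤ C ∧ ∀ (Λ : Finset (SimplicialLattice d)) (i : Λ) (h : Finset Λ → ℝ) (N κ' κ : ℝ),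
      (∀ S, 0 ≤ h S) → 0 ≤ N → κ' < κ →
      (∀ j, ∑ S ∈ simplices Λ with j ∈ S, Real.exp (κ * (diam S : ℝ) ^ α) * h S ≤ N) →
      ∑ S ∈ simplices Λ with i ∈ enlarge S (logRadius a S),
        Real.exp (κ' * (diam S : ℝ) ^ α) * h S ≤
          C * (max 1 (-Real.log (κ - κ'))) ^ (d - 1) * N := by
  have hle : ∀ (Λ : Finset (SimplicialLattice d)) (h : Finset Λ → ℝ) (κ' κ : ℝ),
      (∀ S, 0 ≤ h S) → κ' < κ → ∀ S, Real.exp (κ' * (diam S : ℝ) ^ α) * h S ≤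
        Real.exp (κ * (diam S : ℝ) ^ α) * h S := by
    intro Λ h κ' κ hh hκ S
    have := hh S
    gcongr
  rcases hd.eq_or_lt with h1 | h2
  · refine ⟨1, zero_le_one, fun Λ i h N κ' κ hh hN0 hκ hN => ?_⟩
    have hd1 : d - 1 = 0 := by omega
    rw [hd1, pow_zero, one_mul, one_mul]
    refine le_trans ?_ (hN i)
    have e : (simplices Λ).filter (fun S => i ∈ enlarge S (logRadius a S)) =
        (simplices Λ).filter fun S => i ∈ S := by
      refine Finset.filter_congr fun S hS => ?_
      rw [logRadius, ha h1.symm, zero_mul, enlarge_zero hd hS]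
    rw [e]
    exact Finset.sum_le_sum fun S _ => hle Λ h κ' κ hh hκ S
  · obtain ⟨C₁, hC₁, hhit⟩ := exists_hittingSet_log hd a
    obtain ⟨C₂, hC₂, hlog⟩ := exists_sum_exp_neg_le_log hα₀
    refine ⟨C₁ * C₂, by positivity, fun Λ i h N κ' κ hh hN0 hκ hN => ?_⟩
    set L := max 1 (-Real.log (κ - κ')) with hL
    have hL1 : 1 ≤ L := le_max_left _ _
    set R := Nat.log 2 (diam (Finset.univ : Finset Λ) + 1) + 1
    rw [← Finset.sum_fiberwise_of_maps_to (t := Finset.range R)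
      (g := fun S => Nat.log 2 (diam S + 1)) fun S _ => by
        rw [Finset.mem_range]
        exact Nat.lt_succ_of_le (Nat.log_mono_right (Nat.succ_le_succ (diam_le_diam_univ S)))]
    have hm : ∀ m ∈ Finset.range R, ∑ S ∈ simplices Λ with i ∈ enlarge S (logRadius a S) ∧
        Nat.log 2 (diam S + 1) = m, Real.exp (κ' * (diam S : ℝ) ^ α) * h S ≤
        Real.exp (-((κ - κ') * ((2 : ℝ) ^ m - 1) ^ α)) * (C₁ * N) := by
      intro m _
      obtain ⟨J, hJ, hJS⟩ := hhit Λ i m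
      have h3 : ∑ S ∈ simplices Λ with i ∈ enlarge S (logRadius a S) ∧
          Nat.log 2 (diam S + 1) = m, Real.exp (κ * (diam S : ℝ) ^ α) * h S ≤ C₁ * N := by
        refine (sum_le_card_mul_of_hits (H := J) (Finset.filter_subset _ _)
          (fun S => mul_nonneg (Real.exp_pos _).le (hh S)) (fun S hS => ?_) hN).trans (by gcongr)
        rw [Finset.mem_filter] at hS
        obtain ⟨hS, hi, hSm⟩ := hS
        rw [logRadius, hSm] at hi
        exact hJS S hS hSm hi
      refine le_trans ?_ (mul_le_mul_of_nonneg_left h3 (Real.exp_pos _).le)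
      rw [Finset.mul_sum]
      refine Finset.sum_le_sum fun S hS => ?_
      rw [Finset.mem_filter] at hS
      have h4 : (2 : ℝ) ^ m - 1 ≤ diam S := by
        have : 2 ^ m ≤ diam S + 1 := by
          rw [← hS.2.2]; exact Nat.pow_log_le_self 2 (by omega)
        rw [sub_le_iff_le_add]
        exact_mod_cast this
      have h5 : (1 : ℝ) ≤ 2 ^ m := one_le_pow₀ (by norm_num)
      have h6 : ((2 : ℝ) ^ m - 1) ^ α ≤ (diam S : ℝ) ^ α :=
        Real.rpow_le_rpow (by linarith) h4 hα₀.le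
      rw [← mul_assoc, ← Real.exp_add]
      have := hh S
      gcongr
      nlinarith
    simp only [Finset.filter_filter]
    calc _ ≤ ∑ m ∈ Finset.range R, Real.exp (-((κ - κ') * ((2 : ℝ) ^ m - 1) ^ α)) * (C₁ * N) :=
          Finset.sum_le_sum hm
      _ ≤ C₂ * L * (C₁ * N) := by
          rw [← Finset.sum_mul]
          gcongr
          exact hlog _ (by linarith) R
      _ = C₁ * C₂ * L * N := by ring
      _ ≤ C₁ * C₂ * L ^ (d - 1) * N := by
          gcongr
          exact le_self_pow₀ hL1 (by omega)

end Counting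

/-! ### Telescoping over enlargements -/

section Decomposition

variable {d : ℕ} {Λ : Finset (SimplicialLattice d)} {q : Λ → ℕ}

lemma SupportedIn.sub {S : Finset Λ} {A B : Op q} (hA : SupportedIn S A) (hB : SupportedIn S B) :
    SupportedIn S (A - B) := by
  have e : A - B = A + (-1 : ℂ) • B := by module
  rw [e]
  exact hA.add (hB.smul (-1))

/-- An operator that almost commutes with everything outside the enlargements of `S` is a sum of
operators supported in the enlargements of `S`, of decreasing size. -/
lemma exists_enlarge_decomposition (hq : ∀ i, 1 ≤ q i) (S : Finset Λ) (X : Op q) (r₀ R : ℕ)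
    (hR : r₀ ≤ R) (huniv : enlarge S R = Finset.univ) {β : ℕ → ℝ} (hβ0 : ∀ r, 0 ≤ β r)
    (hβ : Antitone β) (hX : ∀ r, r₀ ≤ r → ∀ B : Op q, SupportedIn (enlarge S r)ᶜ B → ‖B‖ ≤ 1 →
      ‖⁅X, B⁆‖ ≤ β r) :
    ∃ g : ℕ → Op q, (∀ r, SupportedIn (enlarge S r) (g r)) ∧ (∀ r, r < r₀ → g r = 0) ∧
      ‖g r₀‖ ≤ ‖X‖ ∧ (∀ r, r₀ < r → ‖g r‖ ≤ 2 * β (r - 1)) ∧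
      ∑ r ∈ Finset.range (R + 1), g r = X := by
  -- Taking `X` itself once the enlargement is all of `Λ` makes the telescoping sum exact. Below
  -- `r₀` there is no commutator bound, and the value `0` is a dummy that `g` does not use.
  have hQ : ∀ r, ∃ Y : Op q, SupportedIn (enlarge S r) Y ∧
      (r₀ ≤ r → ‖Y‖ ≤ ‖X‖ ∧ ‖X - Y‖ ≤ β r) ∧ (enlarge S r = Finset.univ → Y = X) := by
    intro r
    by_cases hu : enlarge S r = Finset.univ
    · exact ⟨X, hu ▸ supportedIn_univ X, fun _ => ⟨le_rfl, by simpa using hβ0 r⟩, fun _ => rfl⟩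
    · by_cases hr : r₀ ≤ r
      · obtain ⟨Y, h1, h2, h3⟩ := exists_supportedIn_near hq (enlarge S r) X (hX r hr)
        exact ⟨Y, h1, fun _ => ⟨h2, h3⟩, fun h => absurd h hu⟩
      · exact ⟨0, supportedIn_zero _, fun h => absurd h hr, fun h => absurd h hu⟩
  choose Q hQs hQn hQu using hQ
  refine ⟨fun r => if r < r₀ then 0 else if r = r₀ then Q r else Q r - Q (r - 1),
    fun r => ?_, fun r hr => if_pos hr, ?_, fun r hr => ?_, ?_⟩
  · dsimp only
    split_ifs with h1 h2
    · exact supportedIn_zero _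
    · exact hQs r
    · exact (hQs r).sub ((hQs (r - 1)).mono (enlarge_mono S (Nat.sub_le r 1)))
  · simpa using (hQn r₀ le_rfl).1
  · dsimp only
    rw [if_neg (by omega), if_neg (by omega)]
    have h1 := (hQn r hr.le).2
    have h2 := (hQn (r - 1) (by omega)).2
    have h3 := hβ (Nat.sub_le r 1)
    calc ‖Q r - Q (r - 1)‖ = ‖(X - Q (r - 1)) - (X - Q r)‖ := by congr 1; abel
      _ ≤ ‖X - Q (r - 1)‖ + ‖X - Q r‖ := norm_sub_le _ _
      _ ≤ 2 * β (r - 1) := by linarith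
  · rw [← hQu R huniv]
    clear huniv
    induction R, hR using Nat.le_induction with
    | base =>
      rw [Finset.sum_range_succ, Finset.sum_eq_zero fun r hr => if_pos (Finset.mem_range.1 hr)]
      simp
    | succ n hn ih =>
      rw [Finset.sum_range_succ, ih, if_neg (by omega), if_neg (by omega), Nat.add_sub_cancel]
      abel

end Decomposition

end Prethermal
end

/-! ### From local decompositions to `κ`-norm bounds -/

noncomputable section
namespace Prethermal

lemma rpow_add_le_add_rpow {α x y : ℝ} (hα₀ : 0 ≤ α) (hα₁ : α ≤ 1) (hx : 0 ≤ x) (hy : 0 ≤ y) :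
    (x + y) ^ α ≤ x ^ α + y ^ α := by
  lift x to NNReal using hx
  lift y to NNReal using hy
  exact_mod_cast NNReal.rpow_add_le_add_rpow x y hα₀ hα₁

lemma rpow_le_pred_rpow_add_one {α : ℝ} (hα₀ : 0 < α) (hα₁ : α ≤ 1) {r : ℕ} (hr : 0 < r) :
    (r : ℝ) ^ α ≤ ((r - 1 : ℕ) : ℝ) ^ α + 1 := by
  have h := rpow_add_le_add_rpow hα₀.le hα₁ (Nat.cast_nonneg (r - 1)) zero_le_one
  rw [Real.one_rpow] at h
  convert h using 2
  exact_mod_cast (Nat.sub_add_cancel hr).symm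

section KappaNorm

variable {d : ℕ} {Λ : Finset (SimplicialLattice d)} {q : Λ → ℕ}

lemma localNormAt_nonneg (α κ : ℝ) (f : Finset Λ → Op q) (i : Λ) : 0 ≤ localNormAt α κ f i :=
  Finset.sum_nonneg fun _ _ => mul_nonneg (Real.exp_pos _).le (norm_nonneg _)

lemma exists_isLocalDecomposition (hΛ : IsSimplex Λ) (O : Op q) :
    ∃ f : Finset Λ → Op q, IsLocalDecomposition O f := by
  refine ⟨fun S => if S = Finset.univ then O else 0, fun S _ => ?_, ?_⟩
  · dsimp only
    split_ifs with h
    · exact h ▸ supportedIn_univ O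
    · exact supportedIn_zero S
  · rw [Finset.sum_ite_eq', if_pos (univ_mem_simplices hΛ)]

/-- Reduces an inequality between infima to turning each decomposition of `O` into one of `O'`. The
case `D = 0` is separate because the infimum on the right is reached after dividing by `D`. -/
lemma kappaNorm_le_mul (hΛ : IsSimplex Λ) {α κ κ' D : ℝ} (hD : 0 ≤ D) {O O' : Op q}
    (h : ∀ f, IsLocalDecomposition O f → ∀ N, 0 ≤ N → (∀ j, localNormAt α κ f j ≤ N) →
      ∃ f', IsLocalDecomposition O' f' ∧ ∀ i, localNormAt α κ' f' i ≤ D * N) :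
    kappaNorm α κ' O' ≤ D * kappaNorm α κ O := by
  obtain ⟨i₀, -⟩ := nonempty_of_mem_simplices (univ_mem_simplices hΛ)
  have : Nonempty Λ := ⟨i₀⟩
  have hbdd : BddBelow {r : ℝ | ∃ f : Finset Λ → Op q, IsLocalDecomposition O' f ∧
      r = ⨆ i : Λ, localNormAt α κ' f i} :=
    ⟨0, by rintro r ⟨f, -, rfl⟩; exact Real.iSup_nonneg fun i => localNormAt_nonneg _ _ _ _⟩
  have key : ∀ f, IsLocalDecomposition O f →
      kappaNorm α κ' O' ≤ D * ⨆ i : Λ, localNormAt α κ f i := by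
    intro f hf
    obtain ⟨f', hf', hle⟩ := h f hf (⨆ i : Λ, localNormAt α κ f i)
      (Real.iSup_nonneg fun i => localNormAt_nonneg _ _ _ _)
      fun j => le_ciSup (Set.finite_range _).bddAbove j
    exact (csInf_le hbdd ⟨f', hf', rfl⟩).trans (ciSup_le hle)
  obtain ⟨f₀, hf₀⟩ := exists_isLocalDecomposition hΛ O
  rcases hD.eq_or_lt with rfl | hD
  · simpa using key f₀ hf₀
  · rw [← div_le_iff₀' hD]
    refine le_csInf ⟨_, f₀, hf₀, rfl⟩ ?_
    rintro r ⟨f, hf, rfl⟩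
    rw [div_le_iff₀' hD]
    exact key f hf

end KappaNorm

section LocalDecomposition

variable {d : ℕ}

/-- The term at the starting radius is summed with the dyadic count and produces the logarithm.
Those at larger `r` carry `exp(-r^α)`, against which the polynomial number of sites in a box is
summable. -/
lemma exists_localDecomposition_le (hd : 1 ≤ d) {α κ₁ : ℝ} (hα₀ : 0 < α) (hα₁ : α < 1)
    (hκ₁ : 0 ≤ κ₁) (a : ℕ) (ha : d = 1 → a = 0) :
    ∃ C : ℝ, 0 ≤ C ∧ ∀ (Λ : Finset (SimplicialLattice d)) (_ : IsSimplex Λ) (q : Λ → ℕ)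
      (_ : ∀ i, 1 ≤ q i) (M : ℝ) (_ : 0 ≤ M) (f X : Finset Λ → Op q)
      (_ : ∀ S ∈ simplices Λ, ‖X S‖ ≤ M * ‖f S‖)
      (_ : ∀ S ∈ simplices Λ, ∀ r : ℕ, logRadius a S ≤ r → ∀ B : Op q,
        SupportedIn (enlarge S r)ᶜ B → ‖B‖ ≤ 1 →
        ‖⁅X S, B⁆‖ ≤ M * Real.exp (-((κ₁ * ((d : ℝ) + 1) ^ α + 1) * (r : ℝ) ^ α)) * ‖f S‖)
      (κ' κ N : ℝ) (_ : 0 ≤ κ') (_ : κ' < κ) (_ : κ ≤ κ₁) (_ : 0 ≤ N)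
      (_ : ∀ j, localNormAt α κ f j ≤ N),
      ∃ f', IsLocalDecomposition (∑ S ∈ simplices Λ, X S) f' ∧
        ∀ i, localNormAt α κ' f' i ≤ C * M * (max 1 (-Real.log (κ - κ'))) ^ (d - 1) * N := by
  classical
  obtain ⟨C₁, hC₁, hgrow⟩ := exists_rpow_add_log_le hα₀ hα₁
    (b := ((d : ℝ) + 1) * a) (by positivity)
  obtain ⟨C₂, hC₂, hsumlog⟩ := exists_sum_logRadius_le hd hα₀ a ha
  have hsumm := summable_pow_mul_exp_neg_rpow hα₀ (2 * ((d : ℝ) + 1) ^ 2) (by positivity) (d + 1)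
  set C₃ := ∑' r : ℕ, (2 * ((d : ℝ) + 1) ^ 2 * r + 1) ^ (d + 1) * Real.exp (-(r : ℝ) ^ α) with hC₃
  have hC₃0 : 0 ≤ C₃ := tsum_nonneg fun r => by positivity
  -- Enlarging by `r` adds up to `(d + 1) r` to the diameter and costs `exp(κ₁ (d + 1)^α r^α)`; the
  -- extra `1` leaves `exp(-r^α)` for summation.
  set K := κ₁ * ((d : ℝ) + 1) ^ α + 1 with hK
  have hK0 : 0 ≤ K := by positivity
  set c₁ := Real.exp (κ₁ * C₁) with hc₁
  -- The `2` comes from the difference of two approximants, and `exp K` from replacing `r - 1` by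
  -- `r` in the decay.
  set c₂ := 2 * Real.exp K with hc₂
  refine ⟨c₁ * C₂ + c₂ * C₃, by positivity, ?_⟩
  intro Λ hΛ q hq M hM f X hX hcomm κ' κ N hκ' hκκ hκ hN hfN
  set L := max 1 (-Real.log (κ - κ')) with hL
  have hL1 : 1 ≤ L := le_max_left _ _
  have hLd : 1 ≤ L ^ (d - 1) := one_le_pow₀ hL1
  set R := diam (Finset.univ : Finset Λ) + logRadius a (Finset.univ : Finset Λ) with hR
  have hdec : ∀ S : Finset Λ, ∃ g : ℕ → Op q, S ∈ simplices Λ →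
      (∀ r, SupportedIn (enlarge S r) (g r)) ∧ (∀ r < logRadius a S, g r = 0) ∧
      ‖g (logRadius a S)‖ ≤ ‖X S‖ ∧ (∀ r, logRadius a S < r →
        ‖g r‖ ≤ 2 * (M * Real.exp (-(K * ((r - 1 : ℕ) : ℝ) ^ α)) * ‖f S‖)) ∧
      ∑ r ∈ Finset.range (R + 1), g r = X S := by
    intro S
    by_cases hS : S ∈ simplices Λ
    · obtain ⟨g, hg⟩ := exists_enlarge_decomposition hq S (X S) (logRadius a S) R
        ((logRadius_le a S).trans (Nat.le_add_left _ _))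
        (exists_enlarge_eq_univ (nonempty_of_mem_simplices hS) (Nat.le_add_right _ _))
        (β := fun r : ℕ => M * Real.exp (-(K * (r : ℝ) ^ α)) * ‖f S‖)
        (fun r => by positivity) (fun r s hrs => by
          dsimp only
          gcongr) (hcomm S hS)
      exact ⟨g, fun _ => hg⟩
    · exact ⟨0, fun h => absurd h hS⟩
  choose g hg using hdec
  have hterm : ∀ S ∈ simplices Λ, ∀ r,
      Real.exp (κ' * (diam (enlarge S r) : ℝ) ^ α) * ‖g S r‖ ≤
        (if r = logRadius a S then c₁ * M * (Real.exp (κ' * (diam S : ℝ) ^ α) * ‖f S‖) else 0) +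
          c₂ * M * Real.exp (-(r : ℝ) ^ α) * (Real.exp (κ' * (diam S : ℝ) ^ α) * ‖f S‖) := by
    intro S hS r
    obtain ⟨-, hg0, hg1, hg2, -⟩ := hg S hS
    have hdiam : (diam (enlarge S r) : ℝ) ≤ diam S + ((d : ℝ) + 1) * r := by
      exact_mod_cast diam_enlarge_le hd hS r
    have hdα : (diam (enlarge S r) : ℝ) ^ α ≤ (diam S + ((d : ℝ) + 1) * r) ^ α :=
      Real.rpow_le_rpow (Nat.cast_nonneg _) hdiam hα₀.le
    have hpos : 0 ≤ c₂ * M * Real.exp (-(r : ℝ) ^ α) *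
        (Real.exp (κ' * (diam S : ℝ) ^ α) * ‖f S‖) := by positivity
    rcases lt_trichotomy r (logRadius a S) with hr | hr | hr
    · rw [hg0 r hr, norm_zero, mul_zero, if_neg hr.ne, zero_add]
      exact hpos
    · rw [if_pos hr]
      refine le_trans ?_ (le_add_of_nonneg_right hpos)
      have h1 := hgrow (diam S)
      have h2 : ((d : ℝ) + 1) * r = ((d : ℝ) + 1) * a * Nat.log 2 (diam S + 1) := by
        rw [hr, logRadius]; push_cast; ring
      have h3 : κ' * (diam (enlarge S r) : ℝ) ^ α ≤ κ₁ * C₁ + κ' * (diam S : ℝ) ^ α := by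
        rw [h2] at hdα
        have h4 := mul_le_mul_of_nonneg_left (hdα.trans h1) hκ'
        nlinarith
      calc Real.exp (κ' * (diam (enlarge S r) : ℝ) ^ α) * ‖g S r‖
          ≤ Real.exp (κ₁ * C₁ + κ' * (diam S : ℝ) ^ α) * (M * ‖f S‖) := by
            gcongr
            rw [hr]
            exact hg1.trans (hX S hS)
        _ = _ := by rw [Real.exp_add]; ring
    · rw [if_neg hr.ne', zero_add]
      have h1 := rpow_add_le_add_rpow hα₀.le hα₁.le (Nat.cast_nonneg (diam S))
        (show (0 : ℝ) ≤ ((d : ℝ) + 1) * r by positivity)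
      rw [Real.mul_rpow (by positivity) (by positivity)] at h1
      have h2 := rpow_le_pred_rpow_add_one hα₀ hα₁.le (show 0 < r by omega)
      have h3 : κ' * (diam (enlarge S r) : ℝ) ^ α + -(K * ((r - 1 : ℕ) : ℝ) ^ α) ≤
          K + -(r : ℝ) ^ α + κ' * (diam S : ℝ) ^ α := by
        have h4 := mul_le_mul_of_nonneg_left (hdα.trans h1) hκ'
        have h5 := mul_le_mul_of_nonneg_left h2 hK0
        have h6 : κ' * (((d : ℝ) + 1) ^ α * (r : ℝ) ^ α) ≤
            κ₁ * (((d : ℝ) + 1) ^ α * (r : ℝ) ^ α) :=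
          mul_le_mul_of_nonneg_right (hκκ.le.trans hκ) (by positivity)
        have h7 : K * (r : ℝ) ^ α = κ₁ * (((d : ℝ) + 1) ^ α * (r : ℝ) ^ α) + (r : ℝ) ^ α := by
          rw [hK]; ring
        linarith
      calc Real.exp (κ' * (diam (enlarge S r) : ℝ) ^ α) * ‖g S r‖
          ≤ Real.exp (κ' * (diam (enlarge S r) : ℝ) ^ α) *
            (2 * (M * Real.exp (-(K * ((r - 1 : ℕ) : ℝ) ^ α)) * ‖f S‖)) := by
            gcongr
            exact hg2 r hr
        _ = 2 * M * Real.exp (κ' * (diam (enlarge S r) : ℝ) ^ α + -(K * ((r - 1 : ℕ) : ℝ) ^ α)) *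
            ‖f S‖ := by rw [Real.exp_add]; ring
        _ ≤ 2 * M * Real.exp (K + -(r : ℝ) ^ α + κ' * (diam S : ℝ) ^ α) * ‖f S‖ := by gcongr
        _ = _ := by rw [Real.exp_add, Real.exp_add, hc₂]; ring
  -- Different `S` and `r` may have the same enlargement, so all pieces are collected by their
  -- support `Y`.
  refine ⟨fun Y => ∑ S ∈ simplices Λ, ∑ r ∈ Finset.range (R + 1),
    if enlarge S r = Y then g S r else 0, ⟨fun Y _ => ?_, ?_⟩, fun i => ?_⟩
  · refine SupportedIn.sum fun S hS => SupportedIn.sum fun r _ => ?_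
    split_ifs with h
    · exact h ▸ (hg S hS).1 r
    · exact supportedIn_zero Y
  · rw [Finset.sum_comm]
    refine Finset.sum_congr rfl fun S hS => ?_
    rw [Finset.sum_comm, ← (hg S hS).2.2.2.2]
    refine Finset.sum_congr rfl fun r _ => ?_
    rw [Finset.sum_ite_eq, if_pos (enlarge_mem_simplices hd hΛ hS r)]
  · set h : Finset Λ → ℝ := fun S => Real.exp (κ' * (diam S : ℝ) ^ α) * ‖f S‖ with hh
    have hh0 : ∀ S, 0 ≤ h S := fun S => by positivity
    have hhN : ∀ j, ∑ S ∈ simplices Λ with j ∈ S, h S ≤ N := fun j => by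
      refine le_trans (Finset.sum_le_sum fun S _ => ?_) (hfN j)
      simp only [hh]
      gcongr
    calc localNormAt α κ' _ i
        ≤ ∑ Y ∈ simplices Λ with i ∈ Y, ∑ S ∈ simplices Λ, ∑ r ∈ Finset.range (R + 1),
          if enlarge S r = Y then Real.exp (κ' * (diam Y : ℝ) ^ α) * ‖g S r‖ else 0 := by
          refine Finset.sum_le_sum fun Y _ => ?_
          refine (mul_le_mul_of_nonneg_left ((norm_sum_le _ _).trans
            (Finset.sum_le_sum fun S _ => norm_sum_le _ _)) (Real.exp_pos _).le).trans_eq ?_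
          rw [Finset.mul_sum]
          refine Finset.sum_congr rfl fun S _ => ?_
          rw [Finset.mul_sum]
          refine Finset.sum_congr rfl fun r _ => ?_
          split_ifs <;> simp
      _ = ∑ S ∈ simplices Λ, ∑ r ∈ Finset.range (R + 1), if i ∈ enlarge S r then
          Real.exp (κ' * (diam (enlarge S r) : ℝ) ^ α) * ‖g S r‖ else 0 := by
          rw [Finset.sum_comm]
          refine Finset.sum_congr rfl fun S hS => ?_
          rw [Finset.sum_comm]
          refine Finset.sum_congr rfl fun r _ => ?_
          rw [Finset.sum_ite_eq]
          simp only [Finset.mem_filter, enlarge_mem_simplices hd hΛ hS r, true_and]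
      _ ≤ ∑ S ∈ simplices Λ, ∑ r ∈ Finset.range (R + 1), ((if r = logRadius a S then
            (if i ∈ enlarge S (logRadius a S) then c₁ * M * h S else 0) else 0) +
            c₂ * M * Real.exp (-(r : ℝ) ^ α) * if i ∈ enlarge S r then h S else 0) := by
          refine Finset.sum_le_sum fun S hS => Finset.sum_le_sum fun r _ => ?_
          by_cases hi : i ∈ enlarge S r
          · rw [if_pos hi, if_pos hi]
            refine (hterm S hS r).trans_eq ?_
            congr 1
            by_cases hr : r = logRadius a S
            · rw [if_pos hr, if_pos hr, ← hr, if_pos hi]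
            · rw [if_neg hr, if_neg hr]
          · rw [if_neg hi, if_neg hi, mul_zero, add_zero]
            split_ifs
            · have := hh0 S
              positivity
            · exact le_rfl
            · exact le_rfl
      _ = c₁ * M * (∑ S ∈ simplices Λ with i ∈ enlarge S (logRadius a S), h S) +
          ∑ r ∈ Finset.range (R + 1), c₂ * M * Real.exp (-(r : ℝ) ^ α) *
            ∑ S ∈ simplices Λ with i ∈ enlarge S r, h S := by
          simp only [Finset.sum_add_distrib]
          congr 1
          · rw [Finset.mul_sum, Finset.sum_filter]
            refine Finset.sum_congr rfl fun S _ => ?_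
            rw [Finset.sum_ite_eq', if_pos (Finset.mem_range.2 (Nat.lt_succ_of_le
              ((logRadius_le a S).trans (Nat.le_add_left _ _))))]
          · rw [Finset.sum_comm]
            refine Finset.sum_congr rfl fun r _ => ?_
            rw [← Finset.mul_sum, Finset.sum_filter]
      _ ≤ c₁ * M * (C₂ * L ^ (d - 1) * N) + ∑ r ∈ Finset.range (R + 1),
          c₂ * M * N * ((2 * ((d : ℝ) + 1) ^ 2 * r + 1) ^ (d + 1) *
            Real.exp (-(r : ℝ) ^ α)) := by
          refine add_le_add ?_ (Finset.sum_le_sum fun r _ => ?_)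
          · gcongr
            exact hsumlog Λ i (fun S => ‖f S‖) N κ' κ (fun S => norm_nonneg _) hN hκκ hfN
          · refine (mul_le_mul_of_nonneg_left (sum_enlarge_le hd i r hh0 hN hhN)
              (by positivity)).trans_eq ?_
            ring
      _ ≤ c₁ * M * (C₂ * L ^ (d - 1) * N) + c₂ * M * N * C₃ := by
          rw [← Finset.mul_sum]
          gcongr
          exact hsumm.sum_le_tsum _ fun r _ => by positivity
      _ ≤ c₁ * M * (C₂ * L ^ (d - 1) * N) + c₂ * M * N * C₃ * L ^ (d - 1) := by
          exact (add_le_add_iff_left _).2 (le_mul_of_one_le_right (by positivity) hLd)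
      _ = _ := by ring

end LocalDecomposition

end Prethermal
end

/-! ### Lieb–Robinson bounds for time averages -/

noncomputable section
namespace Prethermal

open MeasureTheory

section LiebRobinson

/-- For `d = 1` the boundary has at most two sites and no initial radius is needed, hence `a = 0`.
Otherwise a logarithmic radius absorbs the polynomial size of the boundary. -/
lemma exists_card_boundary_mul_exp_le {d : ℕ} (hd : 1 ≤ d) {c : ℝ} (hc : 0 < c) :
    ∃ a : ℕ, ∃ C : ℝ, 0 ≤ C ∧ (d = 1 → a = 0) ∧
      ∀ (Λ : Finset (SimplicialLattice d)), ∀ S ∈ simplices Λ, ∀ r : ℕ, logRadius a S ≤ r →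
        ((boundary S).card : ℝ) * Real.exp (-(c * r)) ≤ C := by
  rcases hd.eq_or_lt with rfl | h2
  · refine ⟨0, 2, by norm_num, fun _ => rfl, fun Λ S hS r _ => ?_⟩
    have h1 : ((boundary S).card : ℝ) ≤ 2 := by exact_mod_cast card_boundary_le_two hS
    have h3 : Real.exp (-(c * r)) ≤ 1 := Real.exp_le_one_iff.2 (by
      have : 0 ≤ c * r := by positivity
      linarith)
    calc ((boundary S).card : ℝ) * Real.exp (-(c * r)) ≤ 2 * 1 := by gcongr
      _ = 2 := by norm_num
  · obtain ⟨a, ha⟩ := exists_pow_mul_exp_neg_log_le (d + 1) hc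
    refine ⟨a, 4 ^ (d + 1), by positivity, fun h => absurd h h2.ne', fun Λ S hS r hr => ?_⟩
    refine le_trans ?_ (ha (diam S) r hr)
    gcongr
    exact_mod_cast card_boundary_le (nonempty_of_mem_simplices hS)

lemma le_setDist {d : ℕ} {Λ : Finset (SimplicialLattice d)} {S S' : Finset Λ} {r : ℕ}
    (hS : S.Nonempty) (hS' : S'.Nonempty) (h : ∀ x ∈ S, ∀ y ∈ S', r ≤ latticeDist x.1 y.1) :
    r ≤ setDist S S' := by
  obtain ⟨x, hx⟩ := hS
  obtain ⟨y, hy⟩ := hS'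
  refine le_csInf ⟨_, x, hx, y, hy, rfl⟩ ?_
  rintro n ⟨x, hx, y, hy, rfl⟩
  exact h x hx y hy

lemma norm_lie_le {𝔸 : Type*} [NormedRing 𝔸] (X B : 𝔸) : ‖⁅X, B⁆‖ ≤ 2 * ‖X‖ * ‖B‖ := by
  rw [Ring.lie_def]
  refine (norm_sub_le _ _).trans ?_
  have h1 := norm_mul_le X B
  have h2 := norm_mul_le B X
  linarith

/-- If `σ Δ|t| ≤ r/2`, Lieb–Robinson leaves `exp(-μ r/2)`: half of this rate absorbs the boundary,
half dominates `exp(-K r^α)`. Otherwise `r^α ≤ (2σΔ|t|)^α`, so the right-hand side exceeds the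
trivial bound `2‖A‖`; the growth in `t` is left to the filter. -/
lemma exists_norm_lie_evolution_le {d : ℕ} (hd : 1 ≤ d) {α : ℝ} (hα₀ : 0 < α) (hα₁ : α < 1)
    {μ : ℝ} (hμ : 0 < μ) (μ' ρ : ℝ) {K : ℝ} (hK : 0 ≤ K) :
    ∃ a : ℕ, ∃ C c : ℝ, (d = 1 → a = 0) ∧ 1 ≤ C ∧ 0 ≤ c ∧
      ∀ (Λ : Finset (SimplicialLattice d)) (q : Λ → ℕ) (H : Op q) (_ : IsSelfAdjoint H) (Δ : ℝ)
        (_ : 0 < Δ) (_ : LiebRobinsonBound H μ μ' (ρ * Δ)), ∀ S ∈ simplices Λ, ∀ r : ℕ,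
        logRadius a S ≤ r → ∀ A B : Op q, SupportedIn S A → SupportedIn (enlarge S r)ᶜ B →
        ‖B‖ ≤ 1 → ∀ t : ℝ, ‖⁅evolution H t A, B⁆‖ ≤
          C * Real.exp (-(K * (r : ℝ) ^ α)) * ‖A‖ * Real.exp (c * (Δ * |t|) ^ α) := by
  obtain ⟨a, C₁, hC₁, ha, hbd⟩ := exists_card_boundary_mul_exp_le hd
    (show (0 : ℝ) < μ / 4 by positivity)
  obtain ⟨C₂, hC₂, hrpow⟩ := exists_mul_rpow_le_mul_add hα₀ hα₁ hK
    (show (0 : ℝ) < μ / 4 by positivity)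
  set σ := |ρ| + 1 with hσ
  have hσ0 : 0 < σ := by positivity
  have hX : 0 ≤ 2 * |μ'| * C₁ * Real.exp C₂ := by positivity
  refine ⟨a, 2 + 2 * |μ'| * C₁ * Real.exp C₂, K * (2 * σ) ^ α, ha, by linarith, by positivity, ?_⟩
  intro Λ q H hH Δ hΔ hLR S hS r hr A B hA hB hB1 t
  rcases le_or_gt (σ * (Δ * |t|)) (r / 2) with ht | ht
  · have hexp : 1 ≤ Real.exp (K * (2 * σ) ^ α * (Δ * |t|) ^ α) :=
      Real.one_le_exp (by positivity)
    have hdisj : Disjoint S (enlarge S r)ᶜ :=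
      disjoint_compl_right.mono_left (subset_enlarge S r)
    have h1 := hLR S _ hdisj A B hA hB t
    set b : ℝ := min ((boundary S).card : ℝ) ((boundary (enlarge S r)ᶜ).card : ℝ) with hb
    have hb0 : 0 ≤ b := by positivity
    have hmain : b * Real.exp (μ * (ρ * Δ * |t| - (setDist S (enlarge S r)ᶜ : ℝ))) ≤
        C₁ * Real.exp C₂ * Real.exp (-(K * (r : ℝ) ^ α)) := by
      -- For an empty complement `setDist` takes the default value `sInf ∅ = 0` and gives no decay,
      -- but then the boundary factor vanishes.
      rcases (enlarge S r)ᶜ.eq_empty_or_nonempty with he | hne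
      · have : b = 0 := by
          refine le_antisymm ((min_le_right _ _).trans ?_) hb0
          rw [he]
          simp [boundary]
        rw [this, zero_mul]
        positivity
      · have h2 : (r : ℝ) ≤ setDist S (enlarge S r)ᶜ := by
          exact_mod_cast le_setDist (nonempty_of_mem_simplices hS) hne fun x hx y hy =>
            le_latticeDist_of_notMem_enlarge hx (Finset.mem_compl.1 hy)
        have h3 : ρ * Δ * |t| ≤ σ * (Δ * |t|) := by
          rw [mul_assoc]
          have : ρ ≤ σ := (le_abs_self ρ).trans (by linarith)
          gcongr
        have h4 := hrpow r (Nat.cast_nonneg r)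
        have h5 : μ * (ρ * Δ * |t| - (setDist S (enlarge S r)ᶜ : ℝ)) ≤
            -(μ / 4 * r) + (C₂ + -(K * (r : ℝ) ^ α)) := by
          have : μ * (ρ * Δ * |t| - (setDist S (enlarge S r)ᶜ : ℝ)) ≤ μ * (-(r / 2)) := by
            gcongr
            linarith
          linarith
        calc b * Real.exp (μ * (ρ * Δ * |t| - (setDist S (enlarge S r)ᶜ : ℝ)))
            ≤ (boundary S).card * Real.exp (-(μ / 4 * r) + (C₂ + -(K * (r : ℝ) ^ α))) := by
              gcongr
              exact min_le_left _ _
          _ = (boundary S).card * Real.exp (-(μ / 4 * r)) *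
              (Real.exp C₂ * Real.exp (-(K * (r : ℝ) ^ α))) := by
              rw [Real.exp_add, Real.exp_add, mul_assoc]
          _ ≤ C₁ * (Real.exp C₂ * Real.exp (-(K * (r : ℝ) ^ α))) := by
              gcongr
              exact hbd Λ S hS r hr
          _ = _ := by ring
    calc ‖⁅evolution H t A, B⁆‖ ≤ 2 * ‖A‖ * ‖B‖ * μ' * b *
          Real.exp (μ * (ρ * Δ * |t| - (setDist S (enlarge S r)ᶜ : ℝ))) := h1
      _ ≤ 2 * ‖A‖ * 1 * |μ'| * b *
          Real.exp (μ * (ρ * Δ * |t| - (setDist S (enlarge S r)ᶜ : ℝ))) := by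
          gcongr ?_ * b * _
          exact (mul_le_mul_of_nonneg_left (le_abs_self μ') (by positivity)).trans (by gcongr)
      _ = 2 * ‖A‖ * |μ'| *
          (b * Real.exp (μ * (ρ * Δ * |t| - (setDist S (enlarge S r)ᶜ : ℝ)))) := by ring
      _ ≤ 2 * ‖A‖ * |μ'| * (C₁ * Real.exp C₂ * Real.exp (-(K * (r : ℝ) ^ α))) := by gcongr
      _ = 2 * |μ'| * C₁ * Real.exp C₂ * Real.exp (-(K * (r : ℝ) ^ α)) * ‖A‖ := by ring
      _ ≤ (2 + 2 * |μ'| * C₁ * Real.exp C₂) * Real.exp (-(K * (r : ℝ) ^ α)) * ‖A‖ := by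
          gcongr
          linarith
      _ ≤ _ := le_mul_of_one_le_right (by positivity) hexp
  · have h1 : (r : ℝ) ^ α ≤ (2 * σ) ^ α * (Δ * |t|) ^ α := by
      rw [← Real.mul_rpow (by positivity) (by positivity)]
      exact Real.rpow_le_rpow (Nat.cast_nonneg r) (by linarith) hα₀.le
    have h2 : 1 ≤ Real.exp (-(K * (r : ℝ) ^ α) + K * (2 * σ) ^ α * (Δ * |t|) ^ α) :=
      Real.one_le_exp (by
        have := mul_le_mul_of_nonneg_left h1 hK
        linarith)
    calc ‖⁅evolution H t A, B⁆‖ ≤ 2 * ‖evolution H t A‖ * ‖B‖ := norm_lie_le _ _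
      _ ≤ 2 * ‖A‖ * 1 := by
          rw [norm_evolution hH]
          gcongr
      _ = 2 * ‖A‖ := mul_one _
      _ ≤ 2 * ‖A‖ * Real.exp (-(K * (r : ℝ) ^ α) + K * (2 * σ) ^ α * (Δ * |t|) ^ α) :=
          le_mul_of_one_le_right (by positivity) h2
      _ ≤ (2 + 2 * |μ'| * C₁ * Real.exp C₂) * ‖A‖ *
          Real.exp (-(K * (r : ℝ) ^ α) + K * (2 * σ) ^ α * (Δ * |t|) ^ α) := by
          gcongr
          linarith
      _ = _ := by rw [Real.exp_add]; ring

/-- A time average with stretched-exponentially decaying weight is bounded between the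
local norms. -/
lemma exists_kappaNorm_weightedEvolution_le {d : ℕ} (hd : 1 ≤ d) {α κ₁ μ : ℝ} (hα₀ : 0 < α)
    (hα₁ : α < 1) (hκ₁ : 0 ≤ κ₁) (hμ : 0 < μ) (μ' ρ : ℝ) :
    ∃ C c : ℝ, 0 ≤ C ∧ 0 ≤ c ∧ ∀ (Λ : Finset (SimplicialLattice d)) (_ : IsSimplex Λ) (q : Λ → ℕ)
      (_ : ∀ i, 1 ≤ q i) (H : Op q) (_ : IsSelfAdjoint H) (Δ : ℝ) (_ : 0 < Δ)
      (_ : LiebRobinsonBound H μ μ' (ρ * Δ)) (v : ℝ → ℂ) (_ : Integrable v) (M : ℝ)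
      (_ : Integrable fun t => ‖v t‖ * Real.exp (c * (Δ * |t|) ^ α))
      (_ : ∫ t, ‖v t‖ * Real.exp (c * (Δ * |t|) ^ α) ≤ M) (κ' κ : ℝ) (_ : 0 ≤ κ') (_ : κ' < κ)
      (_ : κ ≤ κ₁) (O : Op q), kappaNorm α κ' (weightedEvolution v H O) ≤
        C * M * (max 1 (-Real.log (κ - κ'))) ^ (d - 1) * kappaNorm α κ O := by
  obtain ⟨a, C₁, c, ha, hC₁, hc, hlie⟩ := exists_norm_lie_evolution_le hd hα₀ hα₁ hμ μ' ρ
    (show 0 ≤ κ₁ * ((d : ℝ) + 1) ^ α + 1 by positivity)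
  obtain ⟨C₂, hC₂, hdec⟩ := exists_localDecomposition_le hd hα₀ hα₁ hκ₁ a ha
  refine ⟨C₂ * C₁, c, by positivity, hc, ?_⟩
  intro Λ hΛ q hq H hH Δ hΔ hLR v hv M hvi hvM κ' κ hκ' hκκ hκ O
  have hvM' : ∫ t, ‖v t‖ ≤ M := by
    refine le_trans (integral_mono hv.norm hvi fun t => ?_) hvM
    exact le_mul_of_one_le_right (norm_nonneg _) (Real.one_le_exp (by positivity))
  have hM : 0 ≤ M := (integral_nonneg fun t => norm_nonneg _).trans hvM'
  have hL : (0 : ℝ) ≤ max 1 (-Real.log (κ - κ')) := zero_le_one.trans (le_max_left _ _)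
  refine kappaNorm_le_mul hΛ (by positivity) fun f hf N hN hfN => ?_
  have h := hdec Λ hΛ q hq (C₁ * M) (by positivity) f (fun S => weightedEvolution v H (f S))
    (fun S _ => ?_) (fun S hS r hr B hB hB1 => ?_) κ' κ N hκ' hκκ hκ hN hfN
  · rw [← weightedEvolution_sum hH hv, ← hf.2] at h
    obtain ⟨f', hf', hle⟩ := h
    exact ⟨f', hf', fun i => (hle i).trans_eq (by ring)⟩
  -- The weight is at least `1`, so `M` bounds `∫ ‖v‖`; `1 ≤ C₁` lets the same constant serve both
  -- the norm and the commutator bound.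
  · refine (norm_weightedEvolution_le hH v (f S)).trans ?_
    have : M ≤ C₁ * M := le_mul_of_one_le_left hM hC₁
    gcongr
    linarith
  · set D := C₁ * Real.exp (-((κ₁ * ((d : ℝ) + 1) ^ α + 1) * (r : ℝ) ^ α)) * ‖f S‖ with hD
    have e : (fun t => ‖v t‖ * (D * Real.exp (c * (Δ * |t|) ^ α))) =
        fun t => D * (‖v t‖ * Real.exp (c * (Δ * |t|) ^ α)) := by
      funext t; ring
    have hi : Integrable fun t => ‖v t‖ * (D * Real.exp (c * (Δ * |t|) ^ α)) := by
      rw [e]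
      exact hvi.const_mul D
    have hb := hlie Λ q H hH Δ hΔ hLR S hS r hr (f S) B (hf.1 S hS) hB hB1
    have hk := norm_lie_weightedEvolution_le hH hv hi hb
    refine hk.trans ?_
    rw [e, integral_const_mul]
    calc D * ∫ t, ‖v t‖ * Real.exp (c * (Δ * |t|) ^ α) ≤ D * M :=
          mul_le_mul_of_nonneg_left hvM (by positivity)
      _ = _ := by rw [hD]; ring

lemma superA_eq_weightedEvolution {d : ℕ} {Λ : Finset (SimplicialLattice d)} {q : Λ → ℕ}
    (W : ℝ → ℝ) (H O : Op q) :
    superA W H O = weightedEvolution (fun t => Complex.I * (W t : ℂ)) H O := by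
  unfold superA weightedEvolution
  rw [← integral_smul]
  simp only [smul_smul]

end LiebRobinson

end Prethermal
end

theorem mainTheorem4 :
    ∃ w W : ℝ → ℝ → ℝ,
      (∀ Δ : ℝ, 0 < Δ →
        MeasureTheory.Integrable (w Δ) ∧ MeasureTheory.Integrable (W Δ)) ∧
      (∀ (d : ℕ) (_hd : 1 ≤ d)
        (Λ : Finset (Prethermal.SimplicialLattice d)) (_hΛ : Prethermal.IsSimplex Λ)
        (q : Λ → ℕ) (_hq : ∀ i, 1 ≤ q i)
        (H₀ : Prethermal.Op q) (_hH₀ : IsSelfAdjoint H₀) (Δ : ℝ) (_hΔ : 0 < Δ)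
        (O : Prethermal.Op q),
        Prethermal.IsDeltaDiagonal H₀ Δ (Prethermal.superP (w Δ) H₀ O) ∧
        ⁅H₀, Prethermal.superA (W Δ) H₀ O⁆ + O = Prethermal.superP (w Δ) H₀ O) ∧
      (∀ (d : ℕ) (_hd : 1 ≤ d) (α κ₁ μ μ' ρ : ℝ) (_hα₀ : 0 < α) (_hα₁ : α < 1)
        (_hκ₁ : 0 < κ₁) (_hμ : κ₁ ≤ μ / 5),
        ∃ c_w c_W : ℝ,
          ∀ (Λ : Finset (Prethermal.SimplicialLattice d)) (_hΛ : Prethermal.IsSimplex Λ)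
            (q : Λ → ℕ) (_hq : ∀ i, 1 ≤ q i)
            (H₀ : Prethermal.Op q) (_hH₀ : IsSelfAdjoint H₀)
            (Δ u : ℝ) (_hΔ : 0 < Δ) (_hu : u / Δ = ρ)
            (_hLR : Prethermal.LiebRobinsonBound H₀ μ μ' u)
            (κ' κ : ℝ) (_hκ' : 0 ≤ κ') (_hκ'κ : κ' < κ) (_hκ : κ ≤ κ₁) (O : Prethermal.Op q),
            Prethermal.kappaNorm α κ' (Prethermal.superP (w Δ) H₀ O) ≤
              c_w * (max 1 (-Real.log (κ - κ'))) ^ (d - 1) * Prethermal.kappaNorm α κ O ∧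
            Prethermal.kappaNorm α κ' (Prethermal.superA (W Δ) H₀ O) ≤
              c_W / Δ * (max 1 (-Real.log (κ - κ'))) ^ (d - 1) * Prethermal.kappaNorm α κ O) := by
  open Prethermal MeasureTheory in
  obtain ⟨w, W, hpair, hint⟩ := exists_isFilterPair
  refine ⟨w, W, fun Δ hΔ => ⟨(hpair Δ hΔ).integrable_fst, (hpair Δ hΔ).integrable_snd⟩,
    fun d hd Λ hΛ q hq H hH Δ hΔ O => ⟨isDeltaDiagonal_superP hH (hpair Δ hΔ).band O,
      lie_weightedEvolution_add hH (hpair Δ hΔ) O⟩, ?_⟩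
  intro d hd α κ₁ μ μ' ρ hα₀ hα₁ hκ₁ hμ
  obtain ⟨C, c, hC, hc, hbound⟩ := exists_kappaNorm_weightedEvolution_le hd hα₀ hα₁ hκ₁.le
    (show 0 < μ by linarith) μ' ρ
  -- The rate `c` depends on the local-norm and Lieb–Robinson data while the filters are already
  -- fixed; this is why they must beat every stretched exponential.
  obtain ⟨M, hM, hM'⟩ := hint α hα₀ hα₁ c hc
  refine ⟨C * M, C * M, ?_⟩
  intro Λ hΛ q hq H hH Δ u hΔ hu hLR κ' κ hκ' hκκ hκ O
  -- With `u = ρ Δ`, time enters only through `Δ t`, so the constants do not depend on `Δ`.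
  rw [div_eq_iff hΔ.ne'] at hu
  subst hu
  obtain ⟨⟨hw, hwM⟩, hW, hWM⟩ := hM' Δ hΔ
  constructor
  · refine hbound Λ hΛ q hq H hH Δ hΔ hLR (fun t => (w Δ t : ℂ))
      ((hpair Δ hΔ).integrable_fst.ofReal (𝕜 := ℂ)) M ?_ ?_ κ' κ hκ' hκκ hκ O
    · simpa using hw
    · simpa using hwM
  · rw [superA_eq_weightedEvolution, mul_div_assoc]
    refine hbound Λ hΛ q hq H hH Δ hΔ hLR (fun t => Complex.I * (W Δ t : ℂ))
      (((hpair Δ hΔ).integrable_snd.ofReal (𝕜 := ℂ)).const_mul _) (M / Δ) ?_ ?_ κ' κ hκ' hκκ hκ O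
    · simpa using hW
    · simpa using hWM
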